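/- All Hilbert spaces are finite-dimensional, logarithms of positive semidefinite matrices are taken on the support, and $D(\rho\|\tau)=\mathrm{Tr}[\rho\log\rho]-\mathrm{Tr}[\rho\log\tau]$ if $\operatorname{supp}\rho\subseteq\operatorname{supp}\tau$, $D(\rho\|\tau)=+\infty$ otherwise. Fix $\beta>0$, a system $S\neq 0$ with Hamiltonian $H_S$ and Gibbs state $\tau_S=e^{-\beta H_S}/\mathrm{Tr}\,e^{-\beta H_S}$. Let $B$ be a bath with Hamiltonian $H_B$ and Gibbs state $\hat\tau_B=e^{-\beta H_B}/\mathrm{Tr}\,e^{-\beta H_B}$, let $C=C_1\otimes\cdots\otimes C_n$ be $n\ge 0$ catalysts with Hamiltonians $H_{C_i}$ and states $\eta_{C_i}$, put $\eta_C=\bigotimes_i\eta_{C_i}$, and let $U$ be a unitary on $S\otimes B\otimes C$ with $[U,H_S+H_B+\sum_i H_{C_i}]=0$. Put $$\mathcal T(X)=\mathrm{Tr}_{BC}[U(X\otimes\hat\tau_B\otimes\eta_C)U^\dagger],\qquad \mathcal R(X)=\mathrm{Tr}_{BC}[U^\dagger(X\otimes\hat\tau_B\otimes\eta_C)U].$$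 We say that the catalysts are returned on the input $\rho_S$ if for every $i$ the reduced state of $U(\rho_S\otimes\hat\tau_B\otimes\eta_C)U^\dagger$ on $C_i$ is $\eta_{C_i}$. The data define an $n$-catalytic thermal operation (nCTO) if the catalysts are returned on every input state; a correlating-catalytic thermal operation (CCTO) if, moreover, $\mathrm{Tr}_B[U(\rho_S\otimes\hat\tau_B\otimes\eta_C)U^\dagger]$ is always a product of its reduced states on $S$ and on $C$; and a catalytic thermal operation (CTO) if $n=1$ and $\mathrm{Tr}_B[U(\rho_S\otimes\hat\tau_B\otimes\eta_C)U^\dagger]=\mathcal T(\rho_S)\otimes\eta_C$ for every state $\rho_S$. Then: 1. For every state $\rho_S$, if the catalysts are returned on $\rho_S$ or on $\tau_S$ (in particular, for every nCTO and every $\rho_S$), $$D(\rho_S\|\tau_S)-D(\mathcal T(\rho_S)\|\tau_S)\ \ge\ D(\rho_S\|\mathcal R(\mathcal T(\rho_S))).$$ 2. If the catalysts are returned on $\tau_S$ (in particular, for every nCTO), then $\mathcal T(\tau_S)=\tau_S$ and $\mathcal R$ is the Petz recovery map of $\mathcal T$ with respect to $\tau_S$, that is, $\mathcal R(X)=\tau_S^{1/2}\,\mathcal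 T^\dagger\big[\mathcal T(\tau_S)^{-1/2}X\,\mathcal T(\tau_S)^{-1/2}\big]\tau_S^{1/2}$ for all $X$, with $\mathcal T^\dagger$ the Hilbert-Schmidt adjoint. The map $\mathcal R$ is implemented with the same bath and catalysts by the energy-conserving unitary $U^\dagger$, and $U^\dagger(\tau_S\otimes\hat\tau_B\otimes\eta_C)U=\tau_S\otimes\hat\tau_B\otimes\eta_C$; in particular $U^\dagger$ also returns the catalysts on the input $\tau_S$. 3. $\mathcal R$ belongs to the same class as $\mathcal T$: every CTO and every CCTO is an nCTO, and if the data define an nCTO (respectively a CCTO, a CTO), then $\mathcal R$ is the map of some nCTO (respectively CCTO, CTO) for the same $H_S$, $\beta$ and $n$, with bath and catalysts $B',C'$ in the initial state $\rho_{E'}$ and unitary $U'$. These can be chosen to run the inverse dynamics on the same environment state: there is an isometry $J:B'\otimes C'\to B\otimes C$ with $J\rho_{E'}J^\dagger=\hat\tau_B\otimes\eta_C$ and $U^\dagger(I_S\otimes J)=(I_S\otimes J)U'$. -/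

import Mathlib

open scoped Kronecker ComplexOrder

noncomputable section

namespace QThermo

/-- A density matrix: positive semidefinite with unit trace. -/
def IsState {ι : Type*} [Fintype ι] (ρ : Matrix ι ι ℂ) : Prop :=
  ρ.PosSemidef ∧ ρ.trace = 1

/-- The Gibbs state `exp (-β H) / Tr exp (-β H)`. -/
def gibbs {ι : Type*} [Fintype ι] [DecidableEq ι] (β : ℝ) (H : Matrix ι ι ℂ) : Matrix ι ι ℂ :=
  ((NormedSpace.exp ((-β : ℂ) • H)).trace)⁻¹ • NormedSpace.exp ((-β : ℂ) • H)

/-- Operator logarithm of a Hermitian matrix, evaluated on its support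
(zero eigenvalues are sent to zero, as `Real.log 0 = 0`). -/
def mlog {ι : Type*} [Fintype ι] [DecidableEq ι] (A : Matrix ι ι ℂ) : Matrix ι ι ℂ :=
  cfc Real.log A

/-- `A ^ (1/2)` for a positive semidefinite matrix. -/
def msqrt {ι : Type*} [Fintype ι] [DecidableEq ι] (A : Matrix ι ι ℂ) : Matrix ι ι ℂ :=
  cfc Real.sqrt A

/-- `A ^ (-1/2)` for a positive semidefinite matrix, the inverse being taken on the support. -/
def minvsqrt {ι : Type*} [Fintype ι] [DecidableEq ι] (A : Matrix ι ι ℂ) : Matrix ι ι ℂ :=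
  cfc (fun x : ℝ => (Real.sqrt x)⁻¹) A

open Classical in
/-- Quantum relative entropy `D(ρ‖τ) = Tr[ρ log ρ] - Tr[ρ log τ]` if `supp ρ ⊆ supp τ`
(equivalently, for Hermitian matrices, `ker τ ⊆ ker ρ`), and `+∞` otherwise. -/
def relEntropy {ι : Type*} [Fintype ι] [DecidableEq ι] (ρ τ : Matrix ι ι ℂ) : EReal :=
  if LinearMap.ker τ.mulVecLin ≤ LinearMap.ker ρ.mulVecLin then
    (((ρ * mlog ρ).trace - (ρ * mlog τ).trace).re : EReal)
  else ⊤

/-- Partial trace over the second tensor factor, as a linear map. -/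
def traceSnd {ι κ : Type*} [Fintype κ] : Matrix (ι × κ) (ι × κ) ℂ →ₗ[ℂ] Matrix ι ι ℂ where
  toFun X := Matrix.of fun s s' => ∑ e, X (s, e) (s', e)
  map_add' X Y := by ext s s'; simp [Finset.sum_add_distrib]
  map_smul' a X := by ext s s'; simp [Finset.mul_sum]

/-- Partial trace over the first tensor factor. -/
def traceFst {ι κ : Type*} [Fintype ι] (X : Matrix (ι × κ) (ι × κ) ℂ) : Matrix κ κ ℂ :=
  Matrix.of fun e e' => ∑ s, X (s, e) (s, e')

/-- The tensor product `⨂ i, A i` of finitely many matrices. -/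
def piTensor {n : ℕ} {C : Fin n → Type*} (A : ∀ i, Matrix (C i) (C i) ℂ) :
    Matrix (∀ i, C i) (∀ i, C i) ℂ :=
  Matrix.of fun c c' => ∏ i, A i (c i) (c' i)

/-- The operator acting as `A` on the `i`-th tensor factor and as the identity on the others. -/
def atSite {n : ℕ} {C : Fin n → Type*} [∀ i, DecidableEq (C i)] (i : Fin n) (A : Matrix (C i) (C i) ℂ) :
    Matrix (∀ i, C i) (∀ i, C i) ℂ :=
  Matrix.of fun c c' => if ∀ j, j ≠ i → c j = c' j then A (c i) (c' i) else 0

/-- The reduced matrix on the `i`-th tensor factor. -/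
def siteMarginal {n : ℕ} {C : Fin n → Type*} [∀ i, Fintype (C i)]
    [∀ i, DecidableEq (C i)] (i : Fin n)
    (X : Matrix (∀ i, C i) (∀ i, C i) ℂ) : Matrix (C i) (C i) ℂ :=
  Matrix.of fun a a' => ∑ c : ∀ i, C i, if c i = a then X c (Function.update c i a') else 0

/-- The adjoint of a linear map on matrices for the Hilbert-Schmidt inner product
`⟨A, B⟩ = Tr[Aᴴ B]`. -/
def hsAdjoint {ι : Type*} [Fintype ι] [DecidableEq ι]
    (N : Matrix ι ι ℂ →ₗ[ℂ] Matrix ι ι ℂ) (B : Matrix ι ι ℂ) : Matrix ι ι ℂ :=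
  Matrix.of fun i j => ((N (Matrix.single i j 1)).conjTranspose * B).trace

theorem trace_hsAdjoint {ι : Type*} [Fintype ι] [DecidableEq ι]
    (N : Matrix ι ι ℂ →ₗ[ℂ] Matrix ι ι ℂ) (A B : Matrix ι ι ℂ) :
    (A.conjTranspose * hsAdjoint N B).trace = ((N A).conjTranspose * B).trace := by
  conv_rhs => rw [Matrix.matrix_eq_sum_single A]
  have h : ∀ i j, Matrix.single i j (A i j) = A i j • Matrix.single i j (1 : ℂ) := by
    intro i j; simp
  simp only [h, map_sum, map_smul, Matrix.conjTranspose_sum, Matrix.conjTranspose_smul,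
    Finset.sum_mul, Matrix.trace_sum, Matrix.smul_mul, Matrix.trace_smul]
  rw [Finset.sum_comm]
  simp [Matrix.trace, Matrix.mul_apply, hsAdjoint]

/-- The Petz recovery map of `N` with respect to the reference state `θ`. -/
def petz {ι : Type*} [Fintype ι] [DecidableEq ι]
    (N : Matrix ι ι ℂ →ₗ[ℂ] Matrix ι ι ℂ) (θ X : Matrix ι ι ℂ) : Matrix ι ι ℂ :=
  msqrt θ * hsAdjoint N (minvsqrt (N θ) * X * minvsqrt (N θ)) * msqrt θ

/-- The data of an operation on a system `S` with Hamiltonian `HS`, at inverse temperature `β`,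
which uses a thermal bath `B`, catalysts `C 0, …, C (n-1)` in initial states `η i`, and a global
unitary `U` that conserves the total energy `H_S + H_B + ∑ i, H_{C_i}`.
The requirement that the catalysts be returned is stated separately below. -/
structure Dilation {S : Type*} [Fintype S] [DecidableEq S] (β : ℝ) (HS : Matrix S S ℂ)
    (n : ℕ) where
  B : Type
  [fintypeB : Fintype B]
  [decEqB : DecidableEq B]
  [nonemptyB : Nonempty B]
  C : Fin n → Type
  [fintypeC : ∀ i, Fintype (C i)]
  [decEqC : ∀ i, DecidableEq (C i)]
  HB : Matrix B B ℂ
  hermB : HB.IsHermitian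
  HC : ∀ i, Matrix (C i) (C i) ℂ
  hermC : ∀ i, (HC i).IsHermitian
  η : ∀ i, Matrix (C i) (C i) ℂ
  stateC : ∀ i, IsState (η i)
  U : Matrix (S × (B × (∀ i, C i))) (S × (B × (∀ i, C i))) ℂ
  unitary : U ∈ Matrix.unitaryGroup (S × (B × (∀ i, C i))) ℂ
  energy : Commute U (HS ⊗ₖ (1 : Matrix (B × (∀ i, C i)) (B × (∀ i, C i)) ℂ)
    + (1 : Matrix S S ℂ) ⊗ₖ (HB ⊗ₖ (1 : Matrix (∀ i, C i) (∀ i, C i) ℂ)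
      + (1 : Matrix B B ℂ) ⊗ₖ ∑ i, atSite i (HC i)))

namespace Dilation

attribute [instance] fintypeB decEqB nonemptyB fintypeC decEqC

variable {S : Type*} [Fintype S] [DecidableEq S] {β : ℝ} {HS : Matrix S S ℂ} {n : ℕ}

/-- Basis of the environment (bath and catalysts). -/
abbrev Env (D : Dilation β HS n) : Type := D.B × (∀ i, D.C i)

/-- The initial state `⨂ i, η i` of the catalysts. -/
def catState (D : Dilation β HS n) : Matrix (∀ i, D.C i) (∀ i, D.C i) ℂ := piTensor D.η

/-- The initial state of bath and catalysts. -/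
def envState (D : Dilation β HS n) : Matrix D.Env D.Env ℂ := gibbs β D.HB ⊗ₖ D.catState

/-- The global state `U (ρ ⊗ τ_B ⊗ η_C) U†` after the interaction. -/
def globalOut (D : Dilation β HS n) (ρ : Matrix S S ℂ) : Matrix (S × D.Env) (S × D.Env) ℂ :=
  D.U * (ρ ⊗ₖ D.envState) * D.U.conjTranspose

/-- The operation `T(ρ) = Tr_{BC} [U (ρ ⊗ τ_B ⊗ η_C) U†]`. -/
def channel (D : Dilation β HS n) : Matrix S S ℂ →ₗ[ℂ] Matrix S S ℂ where
  toFun ρ := traceSnd (D.globalOut ρ)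
  map_add' X Y := by
    simp [globalOut, Matrix.add_kronecker, Matrix.mul_add, Matrix.add_mul]
  map_smul' a X := by
    simp [globalOut, Matrix.smul_kronecker]

/-- The map `R(X) = Tr_{BC} [U† (X ⊗ τ_B ⊗ η_C) U]`. -/
def recovery (D : Dilation β HS n) (X : Matrix S S ℂ) : Matrix S S ℂ :=
  traceSnd (D.U.conjTranspose * (X ⊗ₖ D.envState) * D.U)

/-- The final joint state of system and catalysts, `Tr_B [U (ρ ⊗ τ_B ⊗ η_C) U†]`. -/
def sysCatOut (D : Dilation β HS n) (ρ : Matrix S S ℂ) :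
    Matrix (S × (∀ i, D.C i)) (S × (∀ i, D.C i)) ℂ :=
  Matrix.of fun x y => ∑ b, D.globalOut ρ (x.1, (b, x.2)) (y.1, (b, y.2))

/-- On input `ρ`, each catalyst ends up in its initial local state. -/
def ReturnsCatalysts (D : Dilation β HS n) (ρ : Matrix S S ℂ) : Prop :=
  ∀ i, siteMarginal i (traceFst (D.sysCatOut ρ)) = D.η i

/-- `n`-catalytic thermal operation: every catalyst is locally returned, for every input. -/
def IsNCTO (D : Dilation β HS n) : Prop :=
  ∀ ρ, IsState ρ → D.ReturnsCatalysts ρ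

/-- Correlating-catalytic thermal operation: moreover the catalysts, although possibly
correlated among themselves, end up uncorrelated with the system. -/
def IsCCTO (D : Dilation β HS n) : Prop :=
  ∀ ρ, IsState ρ → D.ReturnsCatalysts ρ ∧
    D.sysCatOut ρ = D.channel ρ ⊗ₖ traceFst (D.sysCatOut ρ)

/-- Catalytic thermal operation: a single catalyst, returned unchanged and uncorrelated with the
system. -/
def IsCTO (D : Dilation β HS n) : Prop :=
  n = 1 ∧ ∀ ρ, IsState ρ → D.sysCatOut ρ = D.channel ρ ⊗ₖ D.catState

/-- The same system, bath and catalysts, with the inverse unitary. -/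
def reverse (D : Dilation β HS n) : Dilation β HS n :=
  { D with
    U := D.U.conjTranspose
    unitary := by
      have h := D.unitary
      rw [← Matrix.star_eq_conjTranspose]
      exact Unitary.star_mem h
    energy := by
      have h := D.energy
      have hu : star D.U * D.U = 1 := (Unitary.mem_iff.mp D.unitary).1
      have hu' : D.U * star D.U = 1 := (Unitary.mem_iff.mp D.unitary).2
      rw [← Matrix.star_eq_conjTranspose]
      generalize (HS ⊗ₖ (1 : Matrix (D.B × (∀ i, D.C i)) (D.B × (∀ i, D.C i)) ℂ)
        + (1 : Matrix S S ℂ) ⊗ₖ (D.HB ⊗ₖ (1 : Matrix (∀ i, D.C i) (∀ i, D.C i) ℂ)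
        + (1 : Matrix D.B D.B ℂ) ⊗ₖ ∑ i, atSite i (D.HC i))) = K at h
      have h1 : D.U * K = K * D.U := h
      change star D.U * K = K * star D.U
      calc star D.U * K = star D.U * K * (D.U * star D.U) := by rw [hu', mul_one]
        _ = star D.U * (K * D.U) * star D.U := by simp only [mul_assoc]
        _ = star D.U * (D.U * K) * star D.U := by rw [h1]
        _ = (star D.U * D.U) * K * star D.U := by simp only [mul_assoc]
        _ = K * star D.U := by rw [hu, one_mul] }

/-- `D'` runs the inverse dynamics of `D` on the same environment state: the environment of `D'`
embeds isometrically into that of `D`, the environment states agree under this embedding, and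
the unitary of `D'` is the restriction of the inverse of the unitary of `D`. -/
def RunsInverseOf (D' D : Dilation β HS n) : Prop :=
  ∃ J : Matrix D.Env D'.Env ℂ,
    J.conjTranspose * J = 1 ∧
    J * D'.envState * J.conjTranspose = D.envState ∧
    D.U.conjTranspose * ((1 : Matrix S S ℂ) ⊗ₖ J) = ((1 : Matrix S S ℂ) ⊗ₖ J) * D'.U

end Dilation

end QThermo

end

/-! Write `τ` for the Gibbs state of the system, `E` for the initial environment state, `ω = U(ρ ⊗
E)U†` and `Tρ` for the output.

Inequality. `R(Tρ)` is the system marginal of `K = U†(Tρ ⊗ E)U`, so monotonicity under partial trace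
bounds `D(ρ‖R(Tρ))` by `D(ρ ⊗ E‖K)`, which equals `D(ω‖Tρ ⊗ E)` by unitary invariance. Logarithms of
products split into local terms, so this is `Tr[ρ log ρ] + Tr[E log E] - Tr[Tρ log Tρ] - Tr[ω_E log
E]`. It equals `D(ρ‖τ) - D(Tρ‖τ)` exactly when `Tr[Tρ log τ] + Tr[ω_E log E] = Tr[ρ log τ] + Tr[E
log E]`. If the catalysts are returned on `ρ`, this balance is energy conservation: the Gibbs
logarithms are affine in the Hamiltonians, and the catalyst terms see only the local marginals
(`balance_of_returns`, `relEntropy_recovery_le`). Monotonicity itself comes from operator concavity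
and monotonicity of the logarithm (`submatrix_mlog_le`, `trace_kronecker_mul_mlog_le`).

Petz map. For `ρ = τ` the balance says that `σ = τ ⊗ E` and `UσU†` have relative entropy zero. The
equality case of Klein's inequality, in an eigenbasis, shows that `U` only connects eigenvectors of
`σ` of equal eigenvalue (`eigenvalue_eq_of_trace_mul_mlog_eq`), so `U` commutes with `σ` and with
its square root. Commutation with `σ` gives the balance for every input
(`balance_of_returns_gibbs`), and commutation with the square root turns the Petz formula into `R`
(`recovery_eq_petz`).

Same class. The reversed unitary need not return the catalysts on all inputs. But `E` restricted to
its support is a Gibbs state, of the Hamiltonian `-β⁻¹ log E`, and `U†` restricts to that support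
and conserves the new energy because `U` commutes with `σ`. The whole environment thus becomes a
bath, and one-dimensional catalysts satisfy every return condition
(`exists_runsInverseOf_of_eigenbasis`, `isCCTO_of_subsingleton`). -/

noncomputable section

namespace QThermo

open Matrix

set_option linter.unusedSectionVars false

/-! ### Functional calculus in a unitary eigenbasis. -/

section Diagonalization

variable {ι κ : Type*} [Fintype ι] [DecidableEq ι] [Fintype κ] [DecidableEq κ]

/-- The matrix `W diag(f) Wᴴ`. -/
def conjDiag (W : Matrix ι ι ℂ) (f : ι → ℝ) : Matrix ι ι ℂ :=
  W * diagonal (fun i => (f i : ℂ)) * Wᴴ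

theorem conjTranspose_mul_self_of_mem {W : Matrix ι ι ℂ} (hW : W ∈ unitaryGroup ι ℂ) :
    Wᴴ * W = 1 := mem_unitaryGroup_iff'.mp hW

theorem mul_conjTranspose_self_of_mem {W : Matrix ι ι ℂ} (hW : W ∈ unitaryGroup ι ℂ) :
    W * Wᴴ = 1 := mem_unitaryGroup_iff.mp hW

theorem conjDiag_mul {W : Matrix ι ι ℂ} (hW : W ∈ unitaryGroup ι ℂ) (f g : ι → ℝ) :
    conjDiag W f * conjDiag W g = conjDiag W (f * g) := by
  have h := conjTranspose_mul_self_of_mem hW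
  calc conjDiag W f * conjDiag W g
      = W * diagonal (fun i => (f i : ℂ)) * (Wᴴ * W) * diagonal (fun i => (g i : ℂ)) * Wᴴ := by
        simp only [conjDiag, Matrix.mul_assoc]
    _ = conjDiag W (f * g) := by
        rw [h, Matrix.mul_one, Matrix.mul_assoc W, diagonal_mul_diagonal]
        simp [conjDiag]

theorem conjDiag_add (W : Matrix ι ι ℂ) (f g : ι → ℝ) :
    conjDiag W f + conjDiag W g = conjDiag W (f + g) := by
  simp only [conjDiag, ← Matrix.add_mul, ← Matrix.mul_add, diagonal_add]
  simp

theorem conjDiag_zero (W : Matrix ι ι ℂ) : conjDiag W 0 = 0 := by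
  simp [conjDiag]

theorem conjDiag_sum {α : Type*} (s : Finset α) (W : Matrix ι ι ℂ) (f : α → ι → ℝ) :
    ∑ a ∈ s, conjDiag W (f a) = conjDiag W (∑ a ∈ s, f a) := by
  classical
  induction s using Finset.induction_on with
  | empty => simp [conjDiag_zero]
  | insert a s ha ih => rw [Finset.sum_insert ha, Finset.sum_insert ha, ih, conjDiag_add]

theorem conjDiag_const {W : Matrix ι ι ℂ} (hW : W ∈ unitaryGroup ι ℂ) (c : ℝ) :
    conjDiag W (fun _ => c) = (c : ℂ) • (1 : Matrix ι ι ℂ) := by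
  rw [conjDiag, ← smul_one_eq_diagonal, Matrix.mul_smul, Matrix.smul_mul, Matrix.mul_one,
    mul_conjTranspose_self_of_mem hW]

theorem smul_conjDiag (W : Matrix ι ι ℂ) (c : ℝ) (f : ι → ℝ) :
    (c : ℂ) • conjDiag W f = conjDiag W (fun i => c * f i) := by
  have : diagonal (fun i => ((c * f i : ℝ) : ℂ)) = (c : ℂ) • diagonal (fun i => (f i : ℂ)) := by
    ext i j; by_cases h : i = j <;> simp [diagonal, h]
  rw [conjDiag, conjDiag, this, Matrix.mul_smul, Matrix.smul_mul]

theorem conjDiag_conjTranspose (W : Matrix ι ι ℂ) (f : ι → ℝ) :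
    (conjDiag W f)ᴴ = conjDiag W f := by
  simp only [conjDiag, conjTranspose_mul, conjTranspose_conjTranspose, diagonal_conjTranspose,
    Matrix.mul_assoc]
  congr 3
  ext i; simp

theorem conjDiag_posSemidef (W : Matrix ι ι ℂ) {f : ι → ℝ} (hf : ∀ i, 0 ≤ f i) :
    (conjDiag W f).PosSemidef := by
  refine PosSemidef.mul_mul_conjTranspose_same (posSemidef_diagonal_iff.mpr fun i => ?_) W
  exact_mod_cast hf i

theorem conj_conjDiag (U W : Matrix ι ι ℂ) (f : ι → ℝ) :
    U * conjDiag W f * Uᴴ = conjDiag (U * W) f := by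
  simp only [conjDiag, conjTranspose_mul, Matrix.mul_assoc]

theorem conj_conjDiag_self {W : Matrix ι ι ℂ} (hW : W ∈ unitaryGroup ι ℂ) (f : ι → ℝ) :
    Wᴴ * conjDiag W f * W = diagonal (fun i => (f i : ℂ)) := by
  calc Wᴴ * conjDiag W f * W = (Wᴴ * W) * diagonal (fun i => (f i : ℂ)) * (Wᴴ * W) := by
        simp only [conjDiag, Matrix.mul_assoc]
    _ = _ := by rw [conjTranspose_mul_self_of_mem hW, Matrix.one_mul, Matrix.mul_one]

theorem trace_conjDiag {W : Matrix ι ι ℂ} (hW : W ∈ unitaryGroup ι ℂ) (f : ι → ℝ) :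
    (conjDiag W f).trace = ((∑ i, f i : ℝ) : ℂ) := by
  rw [conjDiag, Matrix.trace_mul_comm, ← Matrix.mul_assoc, conjTranspose_mul_self_of_mem hW,
    Matrix.one_mul, trace_diagonal]
  simp

theorem trace_mul_conjDiag (A W : Matrix ι ι ℂ) (f : ι → ℝ) :
    (A * conjDiag W f).trace = ∑ i, (Wᴴ * A * W) i i * f i := by
  rw [conjDiag, ← Matrix.mul_assoc, Matrix.trace_mul_comm, ← Matrix.mul_assoc, ← Matrix.mul_assoc]
  simp [Matrix.trace, mul_diagonal]

theorem exists_conjDiag {A : Matrix ι ι ℂ} (hA : A.IsHermitian) :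
    ∃ W ∈ unitaryGroup ι ℂ, ∃ f : ι → ℝ, A = conjDiag W f :=
  ⟨hA.eigenvectorUnitary, hA.eigenvectorUnitary.2, hA.eigenvalues, by
    conv_lhs => rw [hA.spectral_theorem, Unitary.conjStarAlgAut_apply]
    rfl⟩

theorem kronecker_conjDiag (W : Matrix ι ι ℂ) (V : Matrix κ κ ℂ) (f : ι → ℝ) (g : κ → ℝ) :
    conjDiag W f ⊗ₖ conjDiag V g = conjDiag (W ⊗ₖ V) (fun x => f x.1 * g x.2) := by
  rw [conjDiag, conjDiag, conjDiag, conjTranspose_kronecker, mul_kronecker_mul, mul_kronecker_mul,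
    diagonal_kronecker_diagonal]
  simp

/-- Functions of `W diag(d) Wᴴ` as an algebra homomorphism. -/
def conjDiagHom {W : Matrix ι ι ℂ} (hW : W ∈ unitaryGroup ι ℂ) : (ι → ℝ) →ₐ[ℝ] Matrix ι ι ℂ where
  toFun := conjDiag W
  map_one' := (conjDiag_const hW 1).trans (by simp)
  map_mul' f g := (conjDiag_mul hW f g).symm
  map_zero' := conjDiag_zero W
  map_add' f g := (conjDiag_add W f g).symm
  commutes' r := by
    refine (conjDiag_const hW r).trans ?_
    rw [Algebra.algebraMap_eq_smul_one]
    ext i j; simp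

/-- Lagrange interpolation at the values of `d` replaces `f` by a polynomial, and polynomials pass
through the algebra homomorphism `conjDiagHom`. The same homomorphism confines the spectrum to the
range of `d`. -/
theorem cfc_conjDiag {W : Matrix ι ι ℂ} (hW : W ∈ unitaryGroup ι ℂ) (d : ι → ℝ) (f : ℝ → ℝ) :
    cfc f (conjDiag W d) = conjDiag W (fun i => f (d i)) := by
  classical
  have hsa : IsSelfAdjoint (conjDiag W d) := conjDiag_conjTranspose W d
  let p : Polynomial ℝ := Lagrange.interpolate (Finset.univ.image d) id f
  have hp : ∀ i, p.eval (d i) = f (d i) := fun i =>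
    Lagrange.eval_interpolate_at_node (v := id) f (Set.injOn_id _)
      (Finset.mem_image_of_mem d (Finset.mem_univ i))
  have hspec : spectrum ℝ (conjDiag W d) ⊆ Set.range d :=
    (AlgHom.spectrum_apply_subset (conjDiagHom hW) d).trans (by
      intro x hx
      by_contra hne
      refine hx ?_
      rw [spectrum.mem_resolventSet_iff, Pi.isUnit_iff]
      intro i
      simp only [Pi.sub_apply, Pi.algebraMap_apply, Algebra.algebraMap_self, RingHom.id_apply]
      exact isUnit_iff_ne_zero.mpr (sub_ne_zero.mpr fun h => hne ⟨i, h.symm⟩))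
  have h1 : cfc f (conjDiag W d) = cfc p.eval (conjDiag W d) := by
    refine cfc_congr fun x hx => ?_
    obtain ⟨i, rfl⟩ := hspec hx
    exact (hp i).symm
  rw [h1, cfc_polynomial p _ hsa]
  have h2 := Polynomial.aeval_algHom_apply (conjDiagHom hW) d p
  refine h2.trans ?_
  change conjDiag W _ = _
  congr 1
  funext i
  rw [← hp i]
  simp

end Diagonalization

/-! ### Partial traces over bipartite systems. -/

section PartialTrace

variable {ι κ μ : Type*} [Fintype ι] [DecidableEq ι] [Fintype κ] [DecidableEq κ]
  [Fintype μ] [DecidableEq μ]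

theorem traceSnd_apply (X : Matrix (ι × κ) (ι × κ) ℂ) (i j : ι) :
    traceSnd X i j = ∑ e, X (i, e) (j, e) := rfl

theorem trace_traceSnd (X : Matrix (ι × κ) (ι × κ) ℂ) : (traceSnd X).trace = X.trace := by
  simp [Matrix.trace, traceSnd_apply, Fintype.sum_prod_type]

theorem trace_traceFst (X : Matrix (ι × κ) (ι × κ) ℂ) : (traceFst X).trace = X.trace := by
  simp [Matrix.trace, traceFst, Fintype.sum_prod_type]
  exact Finset.sum_comm

theorem traceSnd_kronecker (A : Matrix ι ι ℂ) (B : Matrix κ κ ℂ) :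
    traceSnd (A ⊗ₖ B) = B.trace • A := by
  ext i j
  simp [traceSnd_apply, Matrix.trace, ← Finset.mul_sum, mul_comm]

theorem traceFst_kronecker (A : Matrix ι ι ℂ) (B : Matrix κ κ ℂ) :
    traceFst (A ⊗ₖ B) = A.trace • B := by
  ext i j
  simp [traceFst, Matrix.trace, Finset.sum_mul]

theorem kronecker_one_mul_apply (A : Matrix ι ι ℂ) (M : Matrix (ι × κ) (ι × κ) ℂ)
    (x y : ι × κ) : ((A ⊗ₖ (1 : Matrix κ κ ℂ)) * M) x y = ∑ j, A x.1 j * M (j, x.2) y := by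
  simp [Matrix.mul_apply, Fintype.sum_prod_type, Matrix.one_apply]

theorem mul_kronecker_one_apply (A : Matrix ι ι ℂ) (M : Matrix (ι × κ) (ι × κ) ℂ)
    (x y : ι × κ) : (M * (A ⊗ₖ (1 : Matrix κ κ ℂ))) x y = ∑ j, M x (j, y.2) * A j y.1 := by
  simp [Matrix.mul_apply, Fintype.sum_prod_type, Matrix.one_apply]

theorem one_kronecker_mul_apply (B : Matrix κ μ ℂ) (M : Matrix (ι × μ) (ι × κ) ℂ)
    (x y : ι × κ) : (((1 : Matrix ι ι ℂ) ⊗ₖ B) * M) x y = ∑ e, B x.2 e * M (x.1, e) y := by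
  simp [Matrix.mul_apply, Fintype.sum_prod_type, Matrix.one_apply]

theorem mul_one_kronecker_apply (B : Matrix κ μ ℂ) (M : Matrix (ι × μ) (ι × κ) ℂ)
    (x y : ι × μ) : (M * ((1 : Matrix ι ι ℂ) ⊗ₖ B)) x y = ∑ e, M x (y.1, e) * B e y.2 := by
  simp [Matrix.mul_apply, Fintype.sum_prod_type, Matrix.one_apply]

theorem traceSnd_kronecker_one_mul (A : Matrix ι ι ℂ) (M : Matrix (ι × κ) (ι × κ) ℂ) :
    traceSnd ((A ⊗ₖ (1 : Matrix κ κ ℂ)) * M) = A * traceSnd M := by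
  ext i j
  simp only [traceSnd_apply, kronecker_one_mul_apply]
  simp only [Matrix.mul_apply, traceSnd_apply, Finset.mul_sum]
  exact Finset.sum_comm

theorem traceSnd_mul_kronecker_one (A : Matrix ι ι ℂ) (M : Matrix (ι × κ) (ι × κ) ℂ) :
    traceSnd (M * (A ⊗ₖ (1 : Matrix κ κ ℂ))) = traceSnd M * A := by
  ext i j
  simp only [traceSnd_apply, mul_kronecker_one_apply]
  simp only [Matrix.mul_apply, traceSnd_apply, Finset.sum_mul]
  exact Finset.sum_comm

theorem traceSnd_one_kronecker_mul_comm (B : Matrix κ μ ℂ) (M : Matrix (ι × μ) (ι × κ) ℂ) :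
    traceSnd (((1 : Matrix ι ι ℂ) ⊗ₖ B) * M) = traceSnd (M * ((1 : Matrix ι ι ℂ) ⊗ₖ B)) := by
  ext i j
  simp only [traceSnd_apply, one_kronecker_mul_apply, mul_one_kronecker_apply]
  rw [Finset.sum_comm]
  simp only [mul_comm]

theorem traceFst_one_kronecker_mul (B : Matrix κ κ ℂ) (M : Matrix (ι × κ) (ι × κ) ℂ) :
    traceFst (((1 : Matrix ι ι ℂ) ⊗ₖ B) * M) = B * traceFst M := by
  ext i j
  simp only [traceFst, of_apply, one_kronecker_mul_apply]
  simp only [Matrix.mul_apply, of_apply, Finset.mul_sum]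
  exact Finset.sum_comm

theorem traceFst_mul_one_kronecker (B : Matrix κ κ ℂ) (M : Matrix (ι × κ) (ι × κ) ℂ) :
    traceFst (M * ((1 : Matrix ι ι ℂ) ⊗ₖ B)) = traceFst M * B := by
  ext i j
  simp only [traceFst, of_apply, mul_one_kronecker_apply]
  simp only [Matrix.mul_apply, of_apply, Finset.sum_mul]
  exact Finset.sum_comm

theorem trace_mul_kronecker_one (M : Matrix (ι × κ) (ι × κ) ℂ) (A : Matrix ι ι ℂ) :
    (M * (A ⊗ₖ (1 : Matrix κ κ ℂ))).trace = (traceSnd M * A).trace := by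
  rw [← traceSnd_mul_kronecker_one, trace_traceSnd]

theorem trace_mul_one_kronecker (M : Matrix (ι × κ) (ι × κ) ℂ) (B : Matrix κ κ ℂ) :
    (M * ((1 : Matrix ι ι ℂ) ⊗ₖ B)).trace = (traceFst M * B).trace := by
  rw [← traceFst_mul_one_kronecker, trace_traceFst]

theorem traceSnd_conjTranspose (M : Matrix (ι × κ) (ι × κ) ℂ) :
    traceSnd Mᴴ = (traceSnd M)ᴴ := by
  ext i j; simp [traceSnd_apply]

theorem traceSnd_eq_sum_submatrix (M : Matrix (ι × κ) (ι × κ) ℂ) :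
    traceSnd M = ∑ e, M.submatrix (fun i => (i, e)) (fun i => (i, e)) := by
  ext i j; simp [traceSnd_apply, Matrix.sum_apply]

theorem traceFst_eq_sum_submatrix (M : Matrix (ι × κ) (ι × κ) ℂ) :
    traceFst M = ∑ i, M.submatrix (fun e => (i, e)) (fun e => (i, e)) := by
  ext i j; simp [traceFst, Matrix.sum_apply]

theorem posSemidef_sum {α : Type*} (s : Finset α) {A : α → Matrix ι ι ℂ}
    (hA : ∀ a ∈ s, (A a).PosSemidef) : (∑ a ∈ s, A a).PosSemidef := by
  classical
  induction s using Finset.induction_on with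
  | empty => simpa using PosSemidef.zero
  | insert a s ha ih =>
    rw [Finset.sum_insert ha]
    exact (hA a (by simp)).add (ih fun b hb => hA b (by simp [hb]))

theorem posSemidef_traceSnd {M : Matrix (ι × κ) (ι × κ) ℂ} (hM : M.PosSemidef) :
    (traceSnd M).PosSemidef := by
  rw [traceSnd_eq_sum_submatrix]
  exact posSemidef_sum _ fun e _ => hM.submatrix _

theorem posSemidef_traceFst {M : Matrix (ι × κ) (ι × κ) ℂ} (hM : M.PosSemidef) :
    (traceFst M).PosSemidef := by
  rw [traceFst_eq_sum_submatrix]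
  exact posSemidef_sum _ fun e _ => hM.submatrix _

theorem IsState.traceSnd {M : Matrix (ι × κ) (ι × κ) ℂ} (hM : IsState M) :
    IsState (traceSnd M) :=
  ⟨posSemidef_traceSnd hM.1, (trace_traceSnd M).trans hM.2⟩

theorem IsState.traceFst {M : Matrix (ι × κ) (ι × κ) ℂ} (hM : IsState M) :
    IsState (traceFst M) :=
  ⟨posSemidef_traceFst hM.1, (trace_traceFst M).trans hM.2⟩

theorem IsState.kronecker {A : Matrix ι ι ℂ} {B : Matrix κ κ ℂ} (hA : IsState A)
    (hB : IsState B) : IsState (A ⊗ₖ B) :=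
  ⟨hA.1.kronecker hB.1, by rw [trace_kronecker, hA.2, hB.2, one_mul]⟩

theorem IsState.conj {A U : Matrix ι ι ℂ} (hA : IsState A) (hU : U ∈ unitaryGroup ι ℂ) :
    IsState (U * A * Uᴴ) :=
  ⟨hA.1.mul_mul_conjTranspose_same U, by
    rw [Matrix.trace_mul_comm, ← Matrix.mul_assoc, conjTranspose_mul_self_of_mem hU,
      Matrix.one_mul, hA.2]⟩

theorem conjTranspose_mem_unitaryGroup {U : Matrix ι ι ℂ} (hU : U ∈ unitaryGroup ι ℂ) :
    Uᴴ ∈ unitaryGroup ι ℂ := Unitary.star_mem hU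

theorem kronecker_mem_unitaryGroup {U : Matrix ι ι ℂ} {V : Matrix κ κ ℂ}
    (hU : U ∈ unitaryGroup ι ℂ) (hV : V ∈ unitaryGroup κ ℂ) :
    U ⊗ₖ V ∈ unitaryGroup (ι × κ) ℂ := Matrix.kronecker_mem_unitary hU hV

end PartialTrace

/-! ### Tensor products over the catalyst sites and their marginals. -/

section PiTensor

variable {n : ℕ} {C : Fin n → Type*} [∀ i, Fintype (C i)] [∀ i, DecidableEq (C i)]

theorem piTensor_mul (A B : ∀ i, Matrix (C i) (C i) ℂ) :
    piTensor A * piTensor B = piTensor fun i => A i * B i := by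
  ext c c'
  simp only [Matrix.mul_apply, piTensor, of_apply, Finset.prod_univ_sum, Fintype.piFinset_univ,
    Finset.prod_mul_distrib]

theorem piTensor_diagonal (f : ∀ i, C i → ℂ) :
    piTensor (fun i => diagonal (f i)) = diagonal fun c => ∏ i, f i (c i) := by
  ext c c'
  by_cases h : c = c'
  · subst h; simp [piTensor]
  · obtain ⟨i, hi⟩ := Function.ne_iff.mp h
    rw [diagonal_apply_ne _ h]
    exact Finset.prod_eq_zero (Finset.mem_univ i) (diagonal_apply_ne _ hi)

theorem piTensor_one : piTensor (fun i => (1 : Matrix (C i) (C i) ℂ)) = 1 := by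
  have := piTensor_diagonal (fun i (_ : C i) => (1 : ℂ))
  simpa using this

theorem piTensor_conjTranspose (A : ∀ i, Matrix (C i) (C i) ℂ) :
    (piTensor A)ᴴ = piTensor fun i => (A i)ᴴ := by
  ext c c'; simp [piTensor]

theorem trace_piTensor (A : ∀ i, Matrix (C i) (C i) ℂ) :
    (piTensor A).trace = ∏ i, (A i).trace := by
  simp only [Matrix.trace, Finset.prod_univ_sum, Fintype.piFinset_univ]
  rfl

theorem piTensor_mem_unitaryGroup {W : ∀ i, Matrix (C i) (C i) ℂ}
    (hW : ∀ i, W i ∈ unitaryGroup (C i) ℂ) : piTensor W ∈ unitaryGroup (∀ i, C i) ℂ := by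
  rw [mem_unitaryGroup_iff, star_eq_conjTranspose, piTensor_conjTranspose, piTensor_mul]
  simp_rw [fun i => mul_conjTranspose_self_of_mem (hW i)]
  exact piTensor_one

theorem piTensor_conjDiag (W : ∀ i, Matrix (C i) (C i) ℂ) (f : ∀ i, C i → ℝ) :
    piTensor (fun i => conjDiag (W i) (f i)) =
      conjDiag (piTensor W) fun c => ∏ i, f i (c i) := by
  simp only [conjDiag, ← piTensor_mul, piTensor_conjTranspose, piTensor_diagonal]
  simp

theorem atSite_eq_piTensor (i : Fin n) (A : Matrix (C i) (C i) ℂ) :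
    atSite i A = piTensor (Function.update (fun j => (1 : Matrix (C j) (C j) ℂ)) i A) := by
  ext c c'
  simp only [atSite, piTensor, of_apply]
  rw [← Finset.mul_prod_erase _ _ (Finset.mem_univ i), Function.update_self]
  have hcongr : ∏ j ∈ Finset.univ.erase i,
      Function.update (fun j => (1 : Matrix (C j) (C j) ℂ)) i A j (c j) (c' j) =
      ∏ j ∈ Finset.univ.erase i, (1 : Matrix (C j) (C j) ℂ) (c j) (c' j) := by
    refine Finset.prod_congr rfl fun j hj => ?_
    rw [Function.update_of_ne (Finset.ne_of_mem_erase hj)]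
  rw [hcongr]
  split_ifs with h
  · rw [Finset.prod_eq_one, mul_one]
    intro j hj
    rw [h j (Finset.ne_of_mem_erase hj), one_apply_eq]
  · push Not at h
    obtain ⟨j, hj, hne⟩ := h
    have h0 : ∏ j ∈ Finset.univ.erase i, (1 : Matrix (C j) (C j) ℂ) (c j) (c' j) = 0 :=
      Finset.prod_eq_zero (Finset.mem_erase.mpr ⟨hj, Finset.mem_univ j⟩) (one_apply_ne hne)
    rw [h0, mul_zero]

theorem atSite_conjDiag {W : ∀ i, Matrix (C i) (C i) ℂ}
    (hW : ∀ i, W i ∈ unitaryGroup (C i) ℂ) (i : Fin n) (f : C i → ℝ) :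
    atSite i (conjDiag (W i) f) = conjDiag (piTensor W) fun c => f (c i) := by
  have h : Function.update (fun j => (1 : Matrix (C j) (C j) ℂ)) i (conjDiag (W i) f) =
      fun j => conjDiag (W j) (Function.update (fun j (_ : C j) => (1 : ℝ)) i f j) := by
    funext j
    by_cases hj : j = i
    · subst hj; simp
    · simp [Function.update_of_ne hj, conjDiag_const (hW j)]
  rw [atSite_eq_piTensor, h, piTensor_conjDiag]
  congr 1
  funext c
  rw [← Finset.mul_prod_erase _ _ (Finset.mem_univ i), Function.update_self,
    Finset.prod_eq_one, mul_one]
  intro j hj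
  rw [Function.update_of_ne (Finset.ne_of_mem_erase hj)]

theorem sum_ite_eq_off_site {M : Type*} [AddCommMonoid M] (i : Fin n) (c : ∀ i, C i)
    (F : (∀ i, C i) → M) :
    ∑ c', (if ∀ j, j ≠ i → c' j = c j then F c' else 0) = ∑ a, F (Function.update c i a) := by
  rw [← Finset.sum_filter]
  symm
  refine Finset.sum_nbij' (fun a => Function.update c i a) (fun c' => c' i) ?_ ?_ ?_ ?_ ?_
  · intro a _
    simp only [Finset.mem_filter, Finset.mem_univ, true_and]
    intro j hj
    exact Function.update_of_ne hj _ _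
  · simp
  · simp
  · intro c' hc'
    simp only [Finset.mem_filter, Finset.mem_univ, true_and] at hc'
    funext j
    by_cases hj : j = i
    · subst hj; simp
    · simp [Function.update_of_ne hj, hc' j hj]
  · simp

/-- Duality between marginals and local observables; it lets local expectation values be computed
without unfolding `siteMarginal`. -/
theorem trace_mul_atSite (i : Fin n) (X : Matrix (∀ i, C i) (∀ i, C i) ℂ)
    (A : Matrix (C i) (C i) ℂ) :
    (X * atSite i A).trace = (siteMarginal i X * A).trace := by
  simp only [Matrix.trace, diag_apply, Matrix.mul_apply, atSite, siteMarginal, of_apply, mul_ite,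
    mul_zero, Finset.sum_mul, ite_mul, zero_mul]
  have h : ∀ c : ∀ i, C i, ∑ c', (if ∀ j, j ≠ i → c' j = c j then X c c' * A (c' i) (c i) else 0)
      = ∑ a, X c (Function.update c i a) * A a (c i) := fun c => by
    rw [sum_ite_eq_off_site i c fun c' => X c c' * A (c' i) (c i)]
    simp
  simp_rw [h]
  conv_rhs =>
    enter [2, x]
    rw [Finset.sum_comm]
  conv_rhs => rw [Finset.sum_comm]
  refine Finset.sum_congr rfl fun c _ => ?_
  conv_rhs => rw [Finset.sum_comm]
  simp

theorem siteMarginal_piTensor (i : Fin n) {A : ∀ i, Matrix (C i) (C i) ℂ}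
    (hA : ∀ i, (A i).trace = 1) : siteMarginal i (piTensor A) = A i := by
  have key : ∀ B : Matrix (C i) (C i) ℂ,
      (siteMarginal i (piTensor A) * B).trace = (A i * B).trace := by
    intro B
    rw [← trace_mul_atSite, atSite_eq_piTensor, piTensor_mul, trace_piTensor,
      ← Finset.mul_prod_erase _ _ (Finset.mem_univ i), Function.update_self,
      Finset.prod_eq_one, mul_one]
    intro j hj
    rw [Function.update_of_ne (Finset.ne_of_mem_erase hj), Matrix.mul_one, hA]
  ext a a'
  simpa [Matrix.trace_mul_single] using key (Matrix.single a' a 1)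

end PiTensor

/-! ### Operator Jensen inequality for the logarithm. -/

section LogJensen

open scoped Matrix.Norms.L2Operator MatrixOrder

variable {ι κ : Type*} [Fintype ι] [DecidableEq ι] [Fintype κ] [DecidableEq κ]

theorem mlog_conjDiag {W : Matrix ι ι ℂ} (hW : W ∈ unitaryGroup ι ℂ) (d : ι → ℝ) :
    mlog (conjDiag W d) = conjDiag W fun i => Real.log (d i) :=
  cfc_conjDiag hW d Real.log

theorem mlog_conj {A U : Matrix ι ι ℂ} (hA : A.IsHermitian) (hU : U ∈ unitaryGroup ι ℂ) :
    mlog (U * A * Uᴴ) = U * mlog A * Uᴴ := by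
  obtain ⟨W, hW, d, rfl⟩ := exists_conjDiag hA
  rw [conj_conjDiag, mlog_conjDiag hW, conj_conjDiag, mlog_conjDiag (mul_mem hU hW)]

theorem blockDiagonal_conjDiag (W : κ → Matrix ι ι ℂ) (d : κ → ι → ℝ) :
    blockDiagonal (fun e => conjDiag (W e) (d e)) =
      conjDiag (blockDiagonal W) fun x => d x.2 x.1 := by
  have h : diagonal (fun x : ι × κ => ((d x.2 x.1 : ℝ) : ℂ)) =
      blockDiagonal fun e => diagonal fun i => (d e i : ℂ) := by
    rw [blockDiagonal_diagonal]
  rw [conjDiag, h, blockDiagonal_conjTranspose, ← blockDiagonal_mul, ← blockDiagonal_mul]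
  rfl

theorem blockDiagonal_mem_unitaryGroup {W : κ → Matrix ι ι ℂ}
    (hW : ∀ e, W e ∈ unitaryGroup ι ℂ) : blockDiagonal W ∈ unitaryGroup (ι × κ) ℂ := by
  rw [mem_unitaryGroup_iff, star_eq_conjTranspose, blockDiagonal_conjTranspose,
    ← blockDiagonal_mul]
  simp_rw [fun e => mul_conjTranspose_self_of_mem (hW e)]
  exact blockDiagonal_one

theorem mlog_blockDiagonal {B : κ → Matrix ι ι ℂ} (hB : ∀ e, (B e).IsHermitian) :
    mlog (blockDiagonal B) = blockDiagonal fun e => mlog (B e) := by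
  choose W hW d hd using fun e => exists_conjDiag (hB e)
  obtain rfl : B = fun e => conjDiag (W e) (d e) := funext hd
  simp_rw [fun e => mlog_conjDiag (hW e) (d e)]
  rw [blockDiagonal_conjDiag, blockDiagonal_conjDiag,
    mlog_conjDiag (blockDiagonal_mem_unitaryGroup hW)]

theorem sum_smul_mlog_le {α : Type*} (s : Finset α) {w : α → ℝ} {A : α → Matrix ι ι ℂ}
    (hw : ∀ a ∈ s, 0 ≤ w a) (hw1 : ∑ a ∈ s, w a = 1) (hA : ∀ a ∈ s, (A a).PosDef) :
    ∑ a ∈ s, w a • mlog (A a) ≤ mlog (∑ a ∈ s, w a • A a) :=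
  (CFC.concaveOn_log (A := Matrix ι ι ℂ)).le_map_sum hw hw1
    fun a ha => (hA a ha).isStrictlyPositive

theorem mlog_mono {A B : Matrix ι ι ℂ} (hA : A.PosDef) (hAB : A ≤ B) : mlog A ≤ mlog B :=
  CFC.log_le_log hAB hA.isStrictlyPositive

theorem posDef_conj {A U : Matrix ι ι ℂ} (hA : A.PosDef) (hU : U ∈ unitaryGroup ι ℂ) :
    (U * A * Uᴴ).PosDef := by
  refine hA.mul_mul_conjTranspose_same fun x y hxy => ?_
  have h2 : (x ᵥ* U) ᵥ* Uᴴ = (y ᵥ* U) ᵥ* Uᴴ := congrArg (· ᵥ* Uᴴ) hxy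
  rwa [vecMul_vecMul, vecMul_vecMul, mul_conjTranspose_self_of_mem hU, vecMul_one,
    vecMul_one] at h2

theorem sum_units_mul (e e' : κ) :
    ∑ s : κ → ℤˣ, (((s e : ℤˣ) : ℤ) : ℂ) * (((s e' : ℤˣ) : ℤ) : ℂ) =
      if e = e' then (Fintype.card (κ → ℤˣ) : ℂ) else 0 := by
  split_ifs with h
  · subst h
    have : ∀ s : κ → ℤˣ, (((s e : ℤˣ) : ℤ) : ℂ) * (((s e : ℤˣ) : ℤ) : ℂ) = 1 := fun s => by
      rw [← Int.cast_mul, ← Units.val_mul, Int.units_mul_self]; simp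
    simp [this]
  -- Flipping the sign at `e` permutes the sign patterns and negates each summand, so the sum equals
  -- its own negative.
  · have h2 := Fintype.sum_equiv (Equiv.mulLeft (Pi.mulSingle e (-1) : κ → ℤˣ))
      (fun s : κ → ℤˣ => -((((s e : ℤˣ) : ℤ) : ℂ) * (((s e' : ℤˣ) : ℤ) : ℂ)))
      (fun s : κ → ℤˣ => (((s e : ℤˣ) : ℤ) : ℂ) * (((s e' : ℤˣ) : ℤ) : ℂ)) (fun s => by
        simp [Pi.mulSingle_eq_of_ne (Ne.symm h)])
    rw [Finset.sum_neg_distrib] at h2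
    linear_combination (-1 / 2 : ℂ) * h2

/-- The pinching `K ↦ ⨁ e, ⟨e|K|e⟩` is an average over the diagonal sign unitaries. -/
theorem average_sign_conj (K : Matrix (ι × κ) (ι × κ) ℂ) :
    ∑ s : κ → ℤˣ, (Fintype.card (κ → ℤˣ) : ℝ)⁻¹ •
      (diagonal (fun x : ι × κ => (((s x.2 : ℤˣ) : ℤ) : ℂ)) * K *
        (diagonal (fun x : ι × κ => (((s x.2 : ℤˣ) : ℤ) : ℂ)))ᴴ) =
      blockDiagonal fun e => K.submatrix (fun i => (i, e)) (fun i => (i, e)) := by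
  have hN : (Fintype.card (κ → ℤˣ) : ℂ) ≠ 0 := Nat.cast_ne_zero.mpr Fintype.card_ne_zero
  ext ⟨i, e⟩ ⟨j, e'⟩
  have h := sum_units_mul e e'
  have h1 : ∀ s : κ → ℤˣ, ((Fintype.card (κ → ℤˣ) : ℝ)⁻¹ •
      (diagonal (fun x : ι × κ => (((s x.2 : ℤˣ) : ℤ) : ℂ)) * K *
        (diagonal (fun x : ι × κ => (((s x.2 : ℤˣ) : ℤ) : ℂ)))ᴴ)) (i, e) (j, e') =
      (Fintype.card (κ → ℤˣ) : ℂ)⁻¹ * K (i, e) (j, e') *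
        ((((s e : ℤˣ) : ℤ) : ℂ) * (((s e' : ℤˣ) : ℤ) : ℂ)) := fun s => by
    rw [diagonal_conjTranspose, Matrix.smul_apply, mul_diagonal, diagonal_mul, Complex.real_smul]
    simp
    ring
  rw [Matrix.sum_apply, Finset.sum_congr rfl fun s _ => h1 s, ← Finset.mul_sum, h,
    blockDiagonal_apply]
  split_ifs with he
  · subst he
    field_simp
    rfl
  · simp

theorem sign_mem_unitaryGroup (s : κ → ℤˣ) :
    diagonal (fun x : ι × κ => (((s x.2 : ℤˣ) : ℤ) : ℂ)) ∈ unitaryGroup (ι × κ) ℂ := by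
  rw [mem_unitaryGroup_iff, star_eq_conjTranspose, diagonal_conjTranspose, diagonal_mul_diagonal,
    ← diagonal_one]
  congr 1
  funext x
  simp only [Pi.star_apply, star_intCast]
  rw [← Int.cast_mul, ← Units.val_mul, Int.units_mul_self]; simp

/-- Operator Jensen inequality for the logarithm and a coordinate block. -/
theorem submatrix_mlog_le {K : Matrix (ι × κ) (ι × κ) ℂ} (hK : K.PosDef) (e : κ) :
    (mlog K).submatrix (fun i => (i, e)) (fun i => (i, e)) ≤
      mlog (K.submatrix (fun i => (i, e)) (fun i => (i, e))) := by
  have hN : (Fintype.card (κ → ℤˣ) : ℝ) ≠ 0 := Nat.cast_ne_zero.mpr Fintype.card_ne_zero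
  have hpos : ∀ s : κ → ℤˣ, (diagonal (fun x : ι × κ => (((s x.2 : ℤˣ) : ℤ) : ℂ)) * K *
      (diagonal (fun x : ι × κ => (((s x.2 : ℤˣ) : ℤ) : ℂ)))ᴴ).PosDef := fun s =>
    posDef_conj hK (sign_mem_unitaryGroup s)
  -- Operator concavity over the uniform average of sign conjugations: since `mlog` commutes with
  -- unitary conjugation, the left side becomes the pinching of `mlog K` and the right side the
  -- logarithm of the pinching of `K`. Comparing one diagonal block finishes.
  have h := sum_smul_mlog_le (Finset.univ : Finset (κ → ℤˣ))
    (w := fun _ => (Fintype.card (κ → ℤˣ) : ℝ)⁻¹)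
    (A := fun s => diagonal (fun x : ι × κ => (((s x.2 : ℤˣ) : ℤ) : ℂ)) * K *
      (diagonal (fun x : ι × κ => (((s x.2 : ℤˣ) : ℤ) : ℂ)))ᴴ)
    (fun _ _ => by positivity)
    (by rw [Finset.sum_const, Finset.card_univ, nsmul_eq_mul]; exact mul_inv_cancel₀ hN)
    (fun s _ => hpos s)
  rw [average_sign_conj, mlog_blockDiagonal fun e => hK.1.submatrix _] at h
  simp_rw [fun s => mlog_conj hK.1 (sign_mem_unitaryGroup (ι := ι) (κ := κ) s)] at h
  rw [average_sign_conj, Matrix.le_iff] at h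
  have h3 := h.submatrix (fun i => (i, e))
  rw [Matrix.le_iff]
  convert h3 using 1
  ext i j
  simp [blockDiagonal_apply]

theorem mlog_smul {A : Matrix ι ι ℂ} (hA : A.PosDef) {c : ℝ} (hc : 0 < c) :
    mlog (c • A) = mlog A + (Real.log c) • (1 : Matrix ι ι ℂ) := by
  obtain ⟨W, hW, d, rfl⟩ := exists_conjDiag hA.1
  have hd : ∀ i, 0 < d i := by
    have h := posDef_conj hA (conjTranspose_mem_unitaryGroup hW)
    rw [conjTranspose_conjTranspose, conj_conjDiag_self hW] at h
    intro i
    exact_mod_cast (posDef_diagonal_iff.mp h) i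
  have h1 : ∀ (c : ℝ) (M : Matrix ι ι ℂ), c • M = (c : ℂ) • M := fun c M => by ext; simp
  rw [h1, h1, smul_conjDiag, mlog_conjDiag hW, mlog_conjDiag hW, ← conjDiag_const hW,
    conjDiag_add]
  congr 1
  funext i
  simp [Real.log_mul hc.ne' (hd i).ne', add_comm]

/-- An operator log-sum inequality. The term `- log (p e)` is absorbed by rescaling the block at `e`
by `(p e)⁻¹`, and concavity with weights `p e` cancels the rescaling. Blocks of zero weight are
dropped first, since they cannot be rescaled, and restored at the end by operator monotonicity. -/
theorem sum_smul_submatrix_mlog_le {K : Matrix (ι × κ) (ι × κ) ℂ} (hK : K.PosDef)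
    {p : κ → ℝ} (hp : ∀ e, 0 ≤ p e) (hp1 : ∑ e, p e = 1) :
    ∑ e, p e • (mlog K).submatrix (fun i => (i, e)) (fun i => (i, e))
      - (∑ e, p e * Real.log (p e)) • (1 : Matrix ι ι ℂ) ≤ mlog (traceSnd K) := by
  have hKe : ∀ e, (K.submatrix (fun i => (i, e)) (fun i => (i, e))).PosDef := fun e =>
    hK.submatrix (fun i j h => by simpa using h)
  set s := Finset.univ.filter fun e => 0 < p e with hs
  have hps : ∀ e ∉ s, p e = 0 := fun e he =>
    le_antisymm (not_lt.mp (by simpa [hs] using he)) (hp e)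
  have hs1 : ∑ e ∈ s, p e = 1 := by
    rw [← hp1]
    exact Finset.sum_subset (Finset.subset_univ _) fun e _ he => hps e he
  have hne : s.Nonempty := by
    by_contra h
    rw [Finset.not_nonempty_iff_eq_empty.mp h] at hs1
    simp at hs1
  have hpos : ∀ e ∈ s, 0 < p e := fun e he => by simpa [hs] using he
  have hsum : (∑ e ∈ s, K.submatrix (fun i => (i, e)) (fun i => (i, e))).PosDef :=
    posDef_sum hne fun e _ => hKe e
  calc ∑ e, p e • (mlog K).submatrix (fun i => (i, e)) (fun i => (i, e))
        - (∑ e, p e * Real.log (p e)) • (1 : Matrix ι ι ℂ)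
      = ∑ e ∈ s, p e • ((mlog K).submatrix (fun i => (i, e)) (fun i => (i, e))
          - Real.log (p e) • (1 : Matrix ι ι ℂ)) := by
        simp only [smul_sub, Finset.sum_sub_distrib, smul_smul, ← Finset.sum_smul]
        congr 1
        · symm
          refine Finset.sum_subset (Finset.subset_univ _) fun e _ he => ?_
          rw [hps e he, zero_smul]
        · congr 1
          symm
          refine Finset.sum_subset (Finset.subset_univ _) fun e _ he => ?_
          rw [hps e he, zero_mul]
    _ ≤ ∑ e ∈ s, p e • mlog ((p e)⁻¹ • K.submatrix (fun i => (i, e)) (fun i => (i, e))) := by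
        refine Finset.sum_le_sum fun e he => ?_
        refine smul_le_smul_of_nonneg_left ?_ (hp e)
        rw [mlog_smul (hKe e) (inv_pos.mpr (hpos e he)), Real.log_inv, neg_smul, ← sub_eq_add_neg]
        exact sub_le_sub_right (submatrix_mlog_le hK e) _
    _ ≤ mlog (∑ e ∈ s, p e • (p e)⁻¹ • K.submatrix (fun i => (i, e)) (fun i => (i, e))) :=
        sum_smul_mlog_le s (fun e _ => hp e) hs1 fun e he =>
          (hKe e).smul (inv_pos.mpr (hpos e he))
    _ = mlog (∑ e ∈ s, K.submatrix (fun i => (i, e)) (fun i => (i, e))) := by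
        congr 1
        refine Finset.sum_congr rfl fun e he => ?_
        rw [smul_smul, mul_inv_cancel₀ (hpos e he).ne', one_smul]
    _ ≤ mlog (traceSnd K) := by
        refine mlog_mono hsum ?_
        rw [traceSnd_eq_sum_submatrix]
        exact Finset.sum_le_sum_of_subset_of_nonneg (Finset.subset_univ _)
          fun e _ _ => (hKe e).posSemidef.nonneg

end LogJensen

/-! ### Monotonicity of relative entropy under partial trace. -/

section DataProcessing

variable {ι κ : Type*} [Fintype ι] [DecidableEq ι] [Fintype κ] [DecidableEq κ]

theorem trace_mul_re_nonneg {A B : Matrix ι ι ℂ} (hA : A.PosSemidef) (hB : B.PosSemidef) :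
    0 ≤ (A * B).trace.re := by
  obtain ⟨W, hW, d, rfl⟩ := exists_conjDiag hB.1
  have hd : ∀ i, 0 ≤ d i := fun i => by
    have h := hB.conjTranspose_mul_mul_same W
    rw [conj_conjDiag_self hW] at h
    exact_mod_cast (posSemidef_diagonal_iff.mp h) i
  rw [trace_mul_conjDiag, Complex.re_sum]
  refine Finset.sum_nonneg fun i _ => ?_
  have h1 := (Complex.le_def.mp ((hA.conjTranspose_mul_mul_same W).diag_nonneg (i := i))).1
  rw [Complex.re_mul_ofReal]
  exact mul_nonneg h1 (hd i)

theorem nonneg_of_posSemidef_conjDiag {W : Matrix ι ι ℂ} (hW : W ∈ unitaryGroup ι ℂ) {d : ι → ℝ}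
    (h : (conjDiag W d).PosSemidef) (i : ι) : 0 ≤ d i := by
  have h1 := h.conjTranspose_mul_mul_same W
  rw [conj_conjDiag_self hW] at h1
  exact_mod_cast (posSemidef_diagonal_iff.mp h1) i

theorem posDef_conjDiag {W : Matrix ι ι ℂ} (hW : W ∈ unitaryGroup ι ℂ) {d : ι → ℝ}
    (hd : ∀ i, 0 < d i) : (conjDiag W d).PosDef :=
  posDef_conj (posDef_diagonal_iff.mpr fun i => by exact_mod_cast hd i) hW

/-- Rotating the second factor to the eigenbasis `V` leaves the partial trace of `K` unchanged and
turns the left trace into a `p`-weighted sum over diagonal blocks of the logarithm. The operator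
log-sum inequality is then paired with `ρ`. -/
theorem trace_kronecker_mul_mlog_le_of_posDef {ρ : Matrix ι ι ℂ} (hρ : ρ.PosSemidef)
    (hρ1 : ρ.trace = 1) {V : Matrix κ κ ℂ} (hV : V ∈ unitaryGroup κ ℂ) {p : κ → ℝ}
    (hp : ∀ e, 0 ≤ p e) (hp1 : ∑ e, p e = 1) {K : Matrix (ι × κ) (ι × κ) ℂ} (hK : K.PosDef) :
    ((ρ ⊗ₖ conjDiag V p) * mlog K).trace.re - ∑ e, p e * Real.log (p e) ≤
      (ρ * mlog (traceSnd K)).trace.re := by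
  set T : Matrix (ι × κ) (ι × κ) ℂ := (1 : Matrix ι ι ℂ) ⊗ₖ V with hT
  have hTu : T ∈ unitaryGroup (ι × κ) ℂ := kronecker_mem_unitaryGroup (one_mem _) hV
  have hTu' := conjTranspose_mem_unitaryGroup hTu
  have hK' : (Tᴴ * K * T).PosDef := by simpa using posDef_conj hK hTu'
  have hlog : mlog (Tᴴ * K * T) = Tᴴ * mlog K * T := by simpa using mlog_conj hK.1 hTu'
  have htr : traceSnd (Tᴴ * K * T) = traceSnd K := by
    have h1 : Tᴴ = (1 : Matrix ι ι ℂ) ⊗ₖ Vᴴ := by rw [hT, conjTranspose_kronecker]; simp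
    rw [h1, Matrix.mul_assoc, traceSnd_one_kronecker_mul_comm, ← h1, Matrix.mul_assoc,
      mul_conjTranspose_self_of_mem hTu, Matrix.mul_one]
  have hstate : ρ ⊗ₖ conjDiag V p = T * (ρ ⊗ₖ diagonal fun e => (p e : ℂ)) * Tᴴ := by
    rw [hT, conjTranspose_kronecker, ← mul_kronecker_mul, ← mul_kronecker_mul]
    simp [conjDiag]
  have hexp : ((ρ ⊗ₖ conjDiag V p) * mlog K).trace =
      ∑ e, (p e : ℂ) * (ρ * (mlog (Tᴴ * K * T)).submatrix (fun i => (i, e))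
        (fun i => (i, e))).trace := by
    rw [hstate, Matrix.mul_assoc, Matrix.mul_assoc, Matrix.trace_mul_comm, Matrix.mul_assoc,
      hlog]
    simp only [Matrix.trace, diag_apply, Matrix.mul_apply (M := ρ ⊗ₖ _), Fintype.sum_prod_type,
      kroneckerMap_apply, diagonal_apply, Matrix.mul_apply (M := ρ), submatrix_apply, mul_ite,
      mul_zero, ite_mul, zero_mul, Finset.sum_ite_eq, Finset.mem_univ, if_true, Finset.mul_sum]
    rw [Finset.sum_comm]
    refine Finset.sum_congr rfl fun e _ => Finset.sum_congr rfl fun i _ =>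
      Finset.sum_congr rfl fun j _ => ?_
    ring
  have hmain := sum_smul_submatrix_mlog_le hK' hp hp1
  rw [Matrix.le_iff, htr] at hmain
  have h2 := trace_mul_re_nonneg hρ hmain
  rw [hexp]
  simp only [Matrix.mul_sub, Matrix.mul_sum, Matrix.mul_smul, Matrix.trace_sub, Matrix.trace_sum,
    Matrix.trace_smul, hρ1, Complex.sub_re, Complex.re_sum, Complex.real_smul,
    Complex.re_ofReal_mul, Complex.ofReal_re, mul_one] at h2 ⊢
  linarith

theorem apply_diag_eq_zero_of_ker_le {W : Matrix ι ι ℂ} (hW : W ∈ unitaryGroup ι ℂ) {d : ι → ℝ}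
    {A : Matrix ι ι ℂ}
    (h : LinearMap.ker (conjDiag W d).mulVecLin ≤ LinearMap.ker A.mulVecLin) {j : ι}
    (hj : d j = 0) : (Wᴴ * A * W) j j = 0 := by
  have h1 : conjDiag W d *ᵥ (W *ᵥ Pi.single j 1) = 0 := by
    rw [mulVec_mulVec, conjDiag, Matrix.mul_assoc, conjTranspose_mul_self_of_mem hW,
      Matrix.mul_one, ← mulVec_mulVec]
    have : diagonal (fun i => (d i : ℂ)) *ᵥ (Pi.single j 1) = 0 := by
      ext i
      by_cases hij : i = j
      · subst hij; simp [hj]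
      · simp [hij]
    rw [this, mulVec_zero]
  have h2 : A *ᵥ (W *ᵥ Pi.single j 1) = 0 := h (by simpa using h1)
  have h3 : (Wᴴ * A * W) *ᵥ Pi.single j 1 = 0 := by
    rw [← mulVec_mulVec, ← mulVec_mulVec, h2, mulVec_zero]
  simpa using congrFun h3 j

/-- The kernel of `conjDiag W d` is spanned by the columns of `W` with `d j = 0`, and a vanishing
quadratic form of a positive semidefinite matrix puts the vector in its kernel. -/
theorem ker_le_of_apply_diag_eq_zero {W : Matrix ι ι ℂ} (hW : W ∈ unitaryGroup ι ℂ) {d : ι → ℝ}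
    {A : Matrix ι ι ℂ} (hA : A.PosSemidef) (h : ∀ j, d j = 0 → (Wᴴ * A * W) j j = 0) :
    LinearMap.ker (conjDiag W d).mulVecLin ≤ LinearMap.ker A.mulVecLin := by
  intro x hx
  rw [LinearMap.mem_ker, mulVecLin_apply] at hx ⊢
  have hcol : ∀ j, d j = 0 → A *ᵥ (W *ᵥ Pi.single j 1) = 0 := fun j hj => by
    rw [← hA.dotProduct_mulVec_zero_iff, ← h j hj]
    have h1 : (Wᴴ * A * W) j j = star (Pi.single j 1) ⬝ᵥ (Wᴴ * A * W) *ᵥ Pi.single j 1 := by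
      simp
    rw [h1, star_mulVec, ← dotProduct_mulVec, mulVec_mulVec, mulVec_mulVec, Matrix.mul_assoc]
  have hy : diagonal (fun i => (d i : ℂ)) *ᵥ (Wᴴ *ᵥ x) = 0 := by
    have h1 := congrArg (Wᴴ *ᵥ ·) hx
    simpa only [conjDiag, mulVec_mulVec, ← Matrix.mul_assoc, conjTranspose_mul_self_of_mem hW,
      Matrix.one_mul, mulVec_zero] using h1
  have hx' : x = W *ᵥ (Wᴴ *ᵥ x) := by
    rw [mulVec_mulVec, mul_conjTranspose_self_of_mem hW, one_mulVec]
  set y := Wᴴ *ᵥ x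
  have hexp : y = ∑ j, y j • Pi.single j (1 : ℂ) := by
    ext i; simp [Finset.sum_apply, Pi.single_apply]
  rw [hx', hexp, mulVec_sum, mulVec_sum]
  refine Finset.sum_eq_zero fun j _ => ?_
  rw [mulVec_smul, mulVec_smul]
  have h1 := congrFun hy j
  rw [mulVec_diagonal] at h1
  rcases mul_eq_zero.mp h1 with h2 | h2
  · rw [hcol j (by exact_mod_cast h2), smul_zero]
  · rw [h2, zero_smul]

theorem trace_mul_mlog_conjDiag {W : Matrix ι ι ℂ} (hW : W ∈ unitaryGroup ι ℂ) (d : ι → ℝ)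
    (A : Matrix ι ι ℂ) :
    (A * mlog (conjDiag W d)).trace.re = ∑ j, ((Wᴴ * A * W) j j).re * Real.log (d j) := by
  rw [mlog_conjDiag hW, trace_mul_conjDiag, Complex.re_sum]
  simp only [Complex.re_mul_ofReal]

open Filter Topology in
/-- `Tr[A log (K + ε)] → Tr[A log K]` when the support of `A` lies in that of `K`. -/
theorem tendsto_trace_mul_mlog {A K : Matrix ι ι ℂ} (hK : K.PosSemidef)
    (h : LinearMap.ker K.mulVecLin ≤ LinearMap.ker A.mulVecLin) :
    Tendsto (fun ε : ℝ => (A * mlog (K + (ε : ℂ) • (1 : Matrix ι ι ℂ))).trace.re) (𝓝[>] 0)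
      (𝓝 (A * mlog K).trace.re) := by
  obtain ⟨W, hW, d, rfl⟩ := exists_conjDiag hK.1
  simp_rw [← conjDiag_const hW, conjDiag_add, trace_mul_mlog_conjDiag hW]
  refine tendsto_finsetSum _ fun j _ => ?_
  -- Where `d j = 0` the divergent `log ε` carries weight zero by the support condition, so the
  -- default `Real.log 0 = 0` gives the correct limit.
  by_cases hj : d j = 0
  · simp [apply_diag_eq_zero_of_ker_le hW h hj]
  · refine Tendsto.const_mul _ ?_
    have h0 : Tendsto (fun ε : ℝ => d j + ε) (𝓝[>] 0) (𝓝 (d j)) := by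
      have := (by fun_prop : Continuous fun ε : ℝ => d j + ε).tendsto 0
      rw [add_zero] at this
      exact this.mono_left nhdsWithin_le_nhds
    exact (Real.continuousAt_log hj).tendsto.comp h0

/-- If `x` is killed by the partial trace of `K`, the nonnegative quadratic forms of `K` at `x ⊗ e`
sum to zero, so each `x ⊗ e` lies in the kernel of `K` and hence of `ρ ⊗ η`. Summing the quadratic
forms of `ρ ⊗ η` gives back that of `ρ`, as `η` has trace one. -/
theorem ker_traceSnd_le {ρ : Matrix ι ι ℂ} (hρ : ρ.PosSemidef) {η : Matrix κ κ ℂ}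
    (hη1 : η.trace = 1) {K : Matrix (ι × κ) (ι × κ) ℂ} (hK : K.PosSemidef)
    (h : LinearMap.ker K.mulVecLin ≤ LinearMap.ker (ρ ⊗ₖ η).mulVecLin) :
    LinearMap.ker (traceSnd K).mulVecLin ≤ LinearMap.ker ρ.mulVecLin := by
  intro x hx
  rw [LinearMap.mem_ker, mulVecLin_apply] at hx ⊢
  let v : κ → ι × κ → ℂ := fun e y => if y.2 = e then x y.1 else 0
  have hquad : ∀ (M : Matrix (ι × κ) (ι × κ) ℂ) (e : κ),
      star (v e) ⬝ᵥ (M *ᵥ v e) =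
        star x ⬝ᵥ (M.submatrix (fun i => (i, e)) (fun i => (i, e)) *ᵥ x) := by
    intro M e
    simp [v, dotProduct, mulVec, Fintype.sum_prod_type, apply_ite (star : ℂ → ℂ)]
  have hsum : ∑ e, star (v e) ⬝ᵥ (K *ᵥ v e) = 0 := by
    simp_rw [hquad]
    rw [← dotProduct_sum, ← sum_mulVec, ← traceSnd_eq_sum_submatrix, hx, dotProduct_zero]
  have hz : ∀ e, star (v e) ⬝ᵥ (K *ᵥ v e) = 0 := fun e =>
    (Finset.sum_eq_zero_iff_of_nonneg fun e _ => hK.dotProduct_mulVec_nonneg (v e)).mp hsum e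
      (Finset.mem_univ e)
  have hz' : ∀ e, star (v e) ⬝ᵥ ((ρ ⊗ₖ η) *ᵥ v e) = 0 := fun e => by
    have h1 : (ρ ⊗ₖ η) *ᵥ v e = 0 := h ((hK.dotProduct_mulVec_zero_iff _).mp (hz e))
    rw [h1, dotProduct_zero]
  rw [← hρ.dotProduct_mulVec_zero_iff]
  have h2 : ∑ e, star (v e) ⬝ᵥ ((ρ ⊗ₖ η) *ᵥ v e) = 0 := Finset.sum_eq_zero fun e _ => hz' e
  simp_rw [hquad] at h2
  rw [← dotProduct_sum, ← sum_mulVec, ← traceSnd_eq_sum_submatrix, traceSnd_kronecker, hη1,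
    one_smul] at h2
  exact h2

open Filter Topology in
/-- Monotonicity under partial trace of the relative entropy `D(ρ ⊗ η ‖ K)`. -/
theorem trace_kronecker_mul_mlog_le {ρ : Matrix ι ι ℂ} (hρ : IsState ρ)
    {η : Matrix κ κ ℂ} (hη : IsState η) {K : Matrix (ι × κ) (ι × κ) ℂ} (hK : K.PosSemidef)
    (h : LinearMap.ker K.mulVecLin ≤ LinearMap.ker (ρ ⊗ₖ η).mulVecLin) :
    ((ρ ⊗ₖ η) * mlog K).trace.re - (η * mlog η).trace.re ≤
      (ρ * mlog (traceSnd K)).trace.re := by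
  obtain ⟨V, hV, p, hVp⟩ := exists_conjDiag hη.1.1
  have hp : ∀ e, 0 ≤ p e := nonneg_of_posSemidef_conjDiag hV (hVp ▸ hη.1)
  have hp1 : ∑ e, p e = 1 := by
    have h1 := hη.2
    rw [hVp, trace_conjDiag hV] at h1
    exact_mod_cast h1
  have hent : (η * mlog η).trace.re = ∑ e, p e * Real.log (p e) := by
    rw [hVp, trace_mul_mlog_conjDiag hV, conj_conjDiag_self hV]
    simp
  have hne : Nonempty κ := by
    by_contra hne
    rw [not_nonempty_iff] at hne
    simp at hp1
  have hlim1 := (tendsto_trace_mul_mlog hK h).sub_const (η * mlog η).trace.re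
  have hlim2 := tendsto_trace_mul_mlog (posSemidef_traceSnd hK) (ker_traceSnd_le hρ.1 hη.2 hK h)
  -- Adding `ε` to `K` adds `card κ * ε` to its partial trace, so the second limit is taken along
  -- this reparametrisation.
  have hcard : Tendsto (fun ε : ℝ => (Fintype.card κ : ℝ) * ε) (𝓝[>] 0) (𝓝[>] 0) := by
    have hc : (0 : ℝ) < Fintype.card κ := Nat.cast_pos.mpr Fintype.card_pos
    refine tendsto_nhdsWithin_iff.mpr ⟨?_, ?_⟩
    · have := (by fun_prop : Continuous fun ε : ℝ => (Fintype.card κ : ℝ) * ε).tendsto 0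
      rw [mul_zero] at this
      exact this.mono_left nhdsWithin_le_nhds
    · filter_upwards [self_mem_nhdsWithin] with ε hε
      exact mul_pos hc hε
  refine le_of_tendsto_of_tendsto hlim1 (hlim2.comp hcard) ?_
  filter_upwards [self_mem_nhdsWithin] with ε hε
  have hpos : (K + (ε : ℂ) • (1 : Matrix (ι × κ) (ι × κ) ℂ)).PosDef := by
    refine PosDef.posSemidef_add hK (PosDef.one.smul ?_)
    exact_mod_cast hε
  have h1 := trace_kronecker_mul_mlog_le_of_posDef hρ.1 hρ.2 hV hp hp1 hpos
  have h2 : traceSnd (K + (ε : ℂ) • (1 : Matrix (ι × κ) (ι × κ) ℂ)) =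
      traceSnd K + (((Fintype.card κ : ℝ) * ε : ℝ) : ℂ) • (1 : Matrix ι ι ℂ) := by
    rw [map_add, map_smul, ← one_kronecker_one, traceSnd_kronecker, trace_one, smul_smul]
    congr 2
    push_cast
    ring
  rw [h2, ← hVp, ← hent] at h1
  exact h1

end DataProcessing

/-! ### Logarithms of bipartite products, with supports. -/

section ProductLog

variable {ι κ : Type*} [Fintype ι] [DecidableEq ι] [Fintype κ] [DecidableEq κ]

/-- Two functions of one operator are interchangeable in a trace against `M` if they differ only on
eigenvectors where `M` has no weight. This handles the failure of `log (xy) = log x + log y` at zero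
under the convention `Real.log 0 = 0`. -/
theorem trace_mul_conjDiag_congr {M W : Matrix ι ι ℂ} {f g : ι → ℝ}
    (h : ∀ j, f j ≠ g j → (Wᴴ * M * W) j j = 0) :
    (M * conjDiag W f).trace = (M * conjDiag W g).trace := by
  rw [trace_mul_conjDiag, trace_mul_conjDiag]
  refine Finset.sum_congr rfl fun j _ => ?_
  by_cases hj : f j = g j
  · rw [hj]
  · rw [h j hj, zero_mul, zero_mul]

theorem traceSnd_conj_kronecker (W : Matrix ι ι ℂ) {V : Matrix κ κ ℂ} (hV : V ∈ unitaryGroup κ ℂ)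
    (M : Matrix (ι × κ) (ι × κ) ℂ) :
    traceSnd ((W ⊗ₖ V)ᴴ * M * (W ⊗ₖ V)) = Wᴴ * traceSnd M * W := by
  have h1 : W ⊗ₖ V = ((1 : Matrix ι ι ℂ) ⊗ₖ V) * (W ⊗ₖ (1 : Matrix κ κ ℂ)) := by
    rw [← mul_kronecker_mul, Matrix.one_mul, Matrix.mul_one]
  have h2 : (W ⊗ₖ V)ᴴ = (Wᴴ ⊗ₖ (1 : Matrix κ κ ℂ)) * ((1 : Matrix ι ι ℂ) ⊗ₖ Vᴴ) := by
    rw [← mul_kronecker_mul, Matrix.one_mul, Matrix.mul_one, conjTranspose_kronecker]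
  have h3 : ((1 : Matrix ι ι ℂ) ⊗ₖ V) * ((1 : Matrix ι ι ℂ) ⊗ₖ Vᴴ) = 1 := by
    rw [← mul_kronecker_mul, Matrix.one_mul, mul_conjTranspose_self_of_mem hV, one_kronecker_one]
  rw [h1, ← h1, h2, h1, ← Matrix.mul_assoc, traceSnd_mul_kronecker_one]
  congr 1
  rw [Matrix.mul_assoc, Matrix.mul_assoc, traceSnd_kronecker_one_mul,
    traceSnd_one_kronecker_mul_comm, Matrix.mul_assoc, h3, Matrix.mul_one]

theorem traceFst_one_conj {W : Matrix ι ι ℂ} (hW : W ∈ unitaryGroup ι ℂ)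
    (M : Matrix (ι × κ) (ι × κ) ℂ) :
    traceFst ((Wᴴ ⊗ₖ (1 : Matrix κ κ ℂ)) * M * (W ⊗ₖ (1 : Matrix κ κ ℂ))) = traceFst M := by
  have key : ∀ B : Matrix κ κ ℂ,
      (traceFst ((Wᴴ ⊗ₖ (1 : Matrix κ κ ℂ)) * M * (W ⊗ₖ (1 : Matrix κ κ ℂ))) * B).trace =
        (traceFst M * B).trace := fun B => by
    have h1 : (W ⊗ₖ (1 : Matrix κ κ ℂ)) * ((1 : Matrix ι ι ℂ) ⊗ₖ B) * (Wᴴ ⊗ₖ (1 : Matrix κ κ ℂ))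
        = (1 : Matrix ι ι ℂ) ⊗ₖ B := by
      rw [← mul_kronecker_mul, ← mul_kronecker_mul, Matrix.mul_one, Matrix.mul_one,
        Matrix.one_mul, mul_conjTranspose_self_of_mem hW]
    rw [← trace_mul_one_kronecker, ← trace_mul_one_kronecker, Matrix.mul_assoc, Matrix.mul_assoc,
      Matrix.trace_mul_comm, Matrix.mul_assoc, h1]
  ext a a'
  simpa [Matrix.trace_mul_single] using key (Matrix.single a' a 1)

theorem traceFst_conj_kronecker {W : Matrix ι ι ℂ} (hW : W ∈ unitaryGroup ι ℂ) (V : Matrix κ κ ℂ)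
    (M : Matrix (ι × κ) (ι × κ) ℂ) :
    traceFst ((W ⊗ₖ V)ᴴ * M * (W ⊗ₖ V)) = Vᴴ * traceFst M * V := by
  have h1 : W ⊗ₖ V = (W ⊗ₖ (1 : Matrix κ κ ℂ)) * ((1 : Matrix ι ι ℂ) ⊗ₖ V) := by
    rw [← mul_kronecker_mul, Matrix.one_mul, Matrix.mul_one]
  have h2 : (W ⊗ₖ V)ᴴ = ((1 : Matrix ι ι ℂ) ⊗ₖ Vᴴ) * (Wᴴ ⊗ₖ (1 : Matrix κ κ ℂ)) := by
    rw [← mul_kronecker_mul, Matrix.one_mul, Matrix.mul_one, conjTranspose_kronecker]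
  rw [h2, h1, ← Matrix.mul_assoc, traceFst_mul_one_kronecker]
  congr 1
  rw [Matrix.mul_assoc, Matrix.mul_assoc, traceFst_one_kronecker_mul, ← Matrix.mul_assoc,
    traceFst_one_conj hW]

theorem diag_eq_zero_of_traceSnd {M : Matrix (ι × κ) (ι × κ) ℂ} (hM : M.PosSemidef) {i : ι}
    (h : traceSnd M i i = 0) (e : κ) : M (i, e) (i, e) = 0 :=
  (Finset.sum_eq_zero_iff_of_nonneg fun e _ => hM.diag_nonneg (i := (i, e))).mp h e
    (Finset.mem_univ e)

theorem diag_eq_zero_of_traceFst {M : Matrix (ι × κ) (ι × κ) ℂ} (hM : M.PosSemidef) {e : κ}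
    (h : traceFst M e e = 0) (i : ι) : M (i, e) (i, e) = 0 :=
  (Finset.sum_eq_zero_iff_of_nonneg fun i _ => hM.diag_nonneg (i := (i, e))).mp h i
    (Finset.mem_univ i)

/-- A zero of `a` or `b` is a zero diagonal entry of the corresponding rotated marginal, and this
entry is a sum of nonnegative diagonal entries of the rotated `M`. -/
theorem apply_diag_kronecker_eq_zero {M : Matrix (ι × κ) (ι × κ) ℂ} (hM : M.PosSemidef)
    {W : Matrix ι ι ℂ} (hW : W ∈ unitaryGroup ι ℂ) {V : Matrix κ κ ℂ}
    (hV : V ∈ unitaryGroup κ ℂ) {a : ι → ℝ} {b : κ → ℝ}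
    (hA : LinearMap.ker (conjDiag W a).mulVecLin ≤ LinearMap.ker (traceSnd M).mulVecLin)
    (hB : LinearMap.ker (conjDiag V b).mulVecLin ≤ LinearMap.ker (traceFst M).mulVecLin)
    (x : ι × κ) (hx : a x.1 * b x.2 = 0) : ((W ⊗ₖ V)ᴴ * M * (W ⊗ₖ V)) x x = 0 := by
  have hM' := hM.conjTranspose_mul_mul_same (W ⊗ₖ V)
  rcases mul_eq_zero.mp hx with h | h
  · refine diag_eq_zero_of_traceSnd hM' ?_ x.2
    rw [traceSnd_conj_kronecker W hV]
    exact apply_diag_eq_zero_of_ker_le hW hA h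
  · refine diag_eq_zero_of_traceFst hM' ?_ x.1
    rw [traceFst_conj_kronecker hW V]
    exact apply_diag_eq_zero_of_ker_le hV hB h

theorem ker_kronecker_le {M : Matrix (ι × κ) (ι × κ) ℂ} (hM : M.PosSemidef) {A : Matrix ι ι ℂ}
    {B : Matrix κ κ ℂ} (hAh : A.IsHermitian) (hBh : B.IsHermitian)
    (hA : LinearMap.ker A.mulVecLin ≤ LinearMap.ker (traceSnd M).mulVecLin)
    (hB : LinearMap.ker B.mulVecLin ≤ LinearMap.ker (traceFst M).mulVecLin) :
    LinearMap.ker (A ⊗ₖ B).mulVecLin ≤ LinearMap.ker M.mulVecLin := by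
  obtain ⟨W, hW, a, rfl⟩ := exists_conjDiag hAh
  obtain ⟨V, hV, b, rfl⟩ := exists_conjDiag hBh
  rw [kronecker_conjDiag]
  exact ker_le_of_apply_diag_eq_zero (kronecker_mem_unitaryGroup hW hV) hM
    (apply_diag_kronecker_eq_zero hM hW hV hA hB)

theorem trace_mul_mlog_kronecker {M : Matrix (ι × κ) (ι × κ) ℂ} (hM : M.PosSemidef)
    {A : Matrix ι ι ℂ} {B : Matrix κ κ ℂ} (hAh : A.IsHermitian) (hBh : B.IsHermitian)
    (hA : LinearMap.ker A.mulVecLin ≤ LinearMap.ker (traceSnd M).mulVecLin)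
    (hB : LinearMap.ker B.mulVecLin ≤ LinearMap.ker (traceFst M).mulVecLin) :
    (M * mlog (A ⊗ₖ B)).trace =
      (traceSnd M * mlog A).trace + (traceFst M * mlog B).trace := by
  obtain ⟨W, hW, a, rfl⟩ := exists_conjDiag hAh
  obtain ⟨V, hV, b, rfl⟩ := exists_conjDiag hBh
  have h1 : mlog (conjDiag W a) ⊗ₖ (1 : Matrix κ κ ℂ) =
      conjDiag (W ⊗ₖ V) fun x => Real.log (a x.1) := by
    have := kronecker_conjDiag W V (fun i => Real.log (a i)) fun _ => 1
    simpa [conjDiag_const hV, mlog_conjDiag hW] using this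
  have h2 : (1 : Matrix ι ι ℂ) ⊗ₖ mlog (conjDiag V b) =
      conjDiag (W ⊗ₖ V) fun x => Real.log (b x.2) := by
    have := kronecker_conjDiag W V (fun _ => 1) fun e => Real.log (b e)
    simpa [conjDiag_const hW, mlog_conjDiag hV] using this
  rw [← trace_mul_kronecker_one, ← trace_mul_one_kronecker, ← Matrix.trace_add, ← Matrix.mul_add,
    h1, h2, conjDiag_add, kronecker_conjDiag, mlog_conjDiag (kronecker_mem_unitaryGroup hW hV)]
  refine trace_mul_conjDiag_congr fun x hx => ?_
  refine apply_diag_kronecker_eq_zero hM hW hV hA hB x ?_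
  by_contra hne
  exact hx (Real.log_mul (left_ne_zero_of_mul hne) (right_ne_zero_of_mul hne))

/-- If `B x = 0`, then `A ⊗ B` and hence `M` kill every `e_i ⊗ x`; this needs no positivity. -/
theorem ker_traceFst_le {M : Matrix (ι × κ) (ι × κ) ℂ} {A : Matrix ι ι ℂ} {B : Matrix κ κ ℂ}
    (h : LinearMap.ker (A ⊗ₖ B).mulVecLin ≤ LinearMap.ker M.mulVecLin) :
    LinearMap.ker B.mulVecLin ≤ LinearMap.ker (traceFst M).mulVecLin := by
  intro x hx
  rw [LinearMap.mem_ker, mulVecLin_apply] at hx ⊢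
  have h1 : ∀ i, M *ᵥ (fun y : ι × κ => if y.1 = i then x y.2 else 0) = 0 := fun i => by
    refine h ?_
    rw [LinearMap.mem_ker, mulVecLin_apply]
    ext ⟨j, e⟩
    have h2 := congrFun hx e
    simp only [mulVec, dotProduct, Pi.zero_apply] at h2
    simp [mulVec, dotProduct, Fintype.sum_prod_type, mul_assoc, ← Finset.mul_sum, h2]
  ext e
  have h3 : ∀ i, ∑ e', M (i, e) (i, e') * x e' = 0 := fun i => by
    simpa [mulVec, dotProduct, Fintype.sum_prod_type] using congrFun (h1 i) (i, e)
  simp only [mulVec, dotProduct, traceFst, of_apply, Finset.sum_mul, Pi.zero_apply]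
  rw [Finset.sum_comm]
  exact Finset.sum_eq_zero fun i _ => h3 i

end ProductLog

/-! ### Logarithms of products over the catalyst sites. -/

section PiLog

variable {n : ℕ} {C : Fin n → Type*} [∀ i, Fintype (C i)] [∀ i, DecidableEq (C i)]

theorem sum_diag_conj_piTensor {W : ∀ i, Matrix (C i) (C i) ℂ}
    (hW : ∀ i, W i ∈ unitaryGroup (C i) ℂ) (Q : Matrix (∀ i, C i) (∀ i, C i) ℂ) (i : Fin n)
    (f : C i → ℝ) :
    ∑ c, ((piTensor W)ᴴ * Q * piTensor W) c c * f (c i) =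
      (siteMarginal i Q * conjDiag (W i) f).trace := by
  rw [← trace_mul_atSite, atSite_conjDiag hW, trace_mul_conjDiag]

/-- If the product vanishes, some `r i (c i)` does. Testing the marginal at that site against the
indicator of `c i` gives total weight zero, a sum of nonnegative diagonal entries that includes the
one at `c`. -/
theorem apply_diag_piTensor_eq_zero {Q : Matrix (∀ i, C i) (∀ i, C i) ℂ} (hQ : Q.PosSemidef)
    {W : ∀ i, Matrix (C i) (C i) ℂ} (hW : ∀ i, W i ∈ unitaryGroup (C i) ℂ)
    {r : ∀ i, C i → ℝ} (h : ∀ i, siteMarginal i Q = conjDiag (W i) (r i))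
    (c : ∀ i, C i) (hc : ∏ i, r i (c i) = 0) :
    ((piTensor W)ᴴ * Q * piTensor W) c c = 0 := by
  classical
  obtain ⟨i, -, hi⟩ := Finset.prod_eq_zero_iff.mp hc
  have hQ' := hQ.conjTranspose_mul_mul_same (piTensor W)
  have h1 := sum_diag_conj_piTensor hW Q i (fun a => if a = c i then 1 else 0)
  rw [h i, conjDiag_mul (hW i), trace_conjDiag (hW i)] at h1
  have h2 : ∑ a, (r i * fun a => if a = c i then (1 : ℝ) else 0) a = 0 := by
    simp [hi]
  rw [h2, Complex.ofReal_zero] at h1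
  have h3 := (Finset.sum_eq_zero_iff_of_nonneg fun c' _ => ?_).mp h1 c (Finset.mem_univ c)
  · simpa using h3
  · refine mul_nonneg hQ'.diag_nonneg ?_
    split_ifs <;> simp

theorem ker_piTensor_le {Q : Matrix (∀ i, C i) (∀ i, C i) ℂ} (hQ : Q.PosSemidef)
    {η : ∀ i, Matrix (C i) (C i) ℂ} (hη : ∀ i, (η i).IsHermitian)
    (h : ∀ i, siteMarginal i Q = η i) :
    LinearMap.ker (piTensor η).mulVecLin ≤ LinearMap.ker Q.mulVecLin := by
  choose W hW r hr using fun i => exists_conjDiag (hη i)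
  obtain rfl : η = fun i => conjDiag (W i) (r i) := funext hr
  rw [piTensor_conjDiag]
  exact ker_le_of_apply_diag_eq_zero (piTensor_mem_unitaryGroup hW) hQ
    (apply_diag_piTensor_eq_zero hQ hW h)

/-- On the support of `Q` the logarithm of the product is a sum of one-site operators, so only the
local marginals enter. This is why correlations among the returned catalysts do no harm. -/
theorem trace_mul_mlog_piTensor {Q : Matrix (∀ i, C i) (∀ i, C i) ℂ} (hQ : Q.PosSemidef)
    {η : ∀ i, Matrix (C i) (C i) ℂ} (hη : ∀ i, (η i).IsHermitian)
    (h : ∀ i, siteMarginal i Q = η i) :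
    (Q * mlog (piTensor η)).trace = ∑ i, (η i * mlog (η i)).trace := by
  choose W hW r hr using fun i => exists_conjDiag (hη i)
  obtain rfl : η = fun i => conjDiag (W i) (r i) := funext hr
  have h1 : ∑ i, (conjDiag (W i) (r i) * mlog (conjDiag (W i) (r i))).trace =
      ∑ i, (Q * conjDiag (piTensor W) fun c => Real.log (r i (c i))).trace := by
    refine Finset.sum_congr rfl fun i _ => ?_
    rw [← atSite_conjDiag hW i fun a => Real.log (r i a), trace_mul_atSite, h i,
      mlog_conjDiag (hW i)]
  rw [h1, ← Matrix.trace_sum, ← Matrix.mul_sum, conjDiag_sum, piTensor_conjDiag,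
    mlog_conjDiag (piTensor_mem_unitaryGroup hW)]
  refine trace_mul_conjDiag_congr fun c hc => ?_
  refine apply_diag_piTensor_eq_zero hQ hW h c ?_
  by_contra hne
  refine hc ?_
  rw [Real.log_prod fun i hi => Finset.prod_ne_zero_iff.mp hne i hi]
  simp

end PiLog

/-! ### Gibbs states. -/

section Gibbs

variable {ι : Type*} [Fintype ι] [DecidableEq ι]

theorem exp_conjDiag {W : Matrix ι ι ℂ} (hW : W ∈ unitaryGroup ι ℂ) (f : ι → ℝ) :
    NormedSpace.exp (conjDiag W f) = conjDiag W fun i => Real.exp (f i) := by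
  have hinv : W⁻¹ = Wᴴ := inv_eq_right_inv (mul_conjTranspose_self_of_mem hW)
  have hu : IsUnit W := (isUnit_iff_isUnit_det W).mpr
    (isUnit_det_of_right_inverse (mul_conjTranspose_self_of_mem hW))
  rw [conjDiag, ← hinv, Matrix.exp_conj _ _ hu, Matrix.exp_diagonal, hinv, conjDiag]
  congr 3
  funext i
  rw [Pi.coe_exp, ← Complex.exp_eq_exp_ℂ]
  simp

theorem gibbs_conjDiag {W : Matrix ι ι ℂ} (hW : W ∈ unitaryGroup ι ℂ) (β : ℝ) (h : ι → ℝ) :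
    gibbs β (conjDiag W h) =
      conjDiag W fun i => (∑ j, Real.exp (-β * h j))⁻¹ * Real.exp (-β * h i) := by
  have h1 : ((-β : ℂ)) • conjDiag W h = conjDiag W fun i => -β * h i := by
    rw [← smul_conjDiag]; simp
  rw [gibbs, h1, exp_conjDiag hW, trace_conjDiag hW, ← smul_conjDiag]
  simp

variable [Nonempty ι]

theorem sum_exp_pos (f : ι → ℝ) : 0 < ∑ j, Real.exp (f j) :=
  Finset.sum_pos (fun _ _ => Real.exp_pos _) Finset.univ_nonempty

theorem posDef_gibbs (β : ℝ) {H : Matrix ι ι ℂ} (hH : H.IsHermitian) : (gibbs β H).PosDef := by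
  obtain ⟨W, hW, h, rfl⟩ := exists_conjDiag hH
  rw [gibbs_conjDiag hW]
  exact posDef_conjDiag hW fun i => mul_pos (inv_pos.mpr (sum_exp_pos _)) (Real.exp_pos _)

theorem isState_gibbs (β : ℝ) {H : Matrix ι ι ℂ} (hH : H.IsHermitian) : IsState (gibbs β H) := by
  refine ⟨(posDef_gibbs β hH).posSemidef, ?_⟩
  obtain ⟨W, hW, h, rfl⟩ := exists_conjDiag hH
  rw [gibbs_conjDiag hW, trace_conjDiag hW, ← Finset.mul_sum,
    inv_mul_cancel₀ (sum_exp_pos _).ne', Complex.ofReal_one]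

/-- `log τ = -β H - log Z`. -/
theorem exists_mlog_gibbs (β : ℝ) {H : Matrix ι ι ℂ} (hH : H.IsHermitian) :
    ∃ z : ℝ, mlog (gibbs β H) = (-β : ℂ) • H + (z : ℂ) • (1 : Matrix ι ι ℂ) := by
  obtain ⟨W, hW, h, rfl⟩ := exists_conjDiag hH
  refine ⟨Real.log (∑ j, Real.exp (-β * h j))⁻¹, ?_⟩
  have h1 := smul_conjDiag W (-β) h
  rw [Complex.ofReal_neg] at h1
  rw [gibbs_conjDiag hW, mlog_conjDiag hW, h1, ← conjDiag_const hW, conjDiag_add]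
  congr 1
  funext i
  simp only [Pi.add_apply]
  rw [Real.log_mul (inv_pos.mpr (sum_exp_pos _)).ne' (Real.exp_pos _).ne', Real.log_exp, add_comm]

theorem ker_le_of_posDef {A B : Matrix ι ι ℂ} (hA : A.PosDef) :
    LinearMap.ker A.mulVecLin ≤ LinearMap.ker B.mulVecLin := by
  intro x hx
  rw [LinearMap.mem_ker, mulVecLin_apply] at hx ⊢
  have : x = 0 := by
    have h := mulVec_injective_of_isUnit hA.isUnit
    exact h (by rw [hx, mulVec_zero])
  rw [this, mulVec_zero]

end Gibbs

theorem isState_piTensor {n : ℕ} {C : Fin n → Type*} [∀ i, Fintype (C i)] [∀ i, DecidableEq (C i)]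
    {η : ∀ i, Matrix (C i) (C i) ℂ} (hη : ∀ i, IsState (η i)) : IsState (piTensor η) := by
  constructor
  · choose W hW r hr using fun i => exists_conjDiag (hη i).1.1
    obtain rfl : η = fun i => conjDiag (W i) (r i) := funext hr
    rw [piTensor_conjDiag]
    exact conjDiag_posSemidef _ fun c => Finset.prod_nonneg fun i _ =>
      nonneg_of_posSemidef_conjDiag (hW i) (hη i).1 _
  · rw [trace_piTensor]
    exact Finset.prod_eq_one fun i _ => (hη i).2

/-! ### Energy balance and the recovery inequality. -/

namespace Dilation

variable {S : Type*} [Fintype S] [DecidableEq S] {β : ℝ} {HS : Matrix S S ℂ} {n : ℕ}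

/-- The total Hamiltonian `H_S + H_B + ∑ i, H_{C_i}`. -/
def totalEnergy (D : Dilation β HS n) : Matrix (S × D.Env) (S × D.Env) ℂ :=
  HS ⊗ₖ (1 : Matrix D.Env D.Env ℂ)
    + (1 : Matrix S S ℂ) ⊗ₖ (D.HB ⊗ₖ (1 : Matrix (∀ i, D.C i) (∀ i, D.C i) ℂ)
      + (1 : Matrix D.B D.B ℂ) ⊗ₖ ∑ i, atSite i (D.HC i))

theorem isState_catState (D : Dilation β HS n) : IsState D.catState := isState_piTensor D.stateC

theorem isState_envState (D : Dilation β HS n) : IsState D.envState :=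
  (isState_gibbs β D.hermB).kronecker D.isState_catState

theorem isState_globalOut (D : Dilation β HS n) {ρ : Matrix S S ℂ} (hρ : IsState ρ) :
    IsState (D.globalOut ρ) :=
  (hρ.kronecker D.isState_envState).conj D.unitary

theorem traceFst_sysCatOut (D : Dilation β HS n) (ρ : Matrix S S ℂ) :
    traceFst (D.sysCatOut ρ) = traceFst (traceFst (D.globalOut ρ)) := by
  ext c c'
  simp only [traceFst, sysCatOut, of_apply]
  exact Finset.sum_comm

/-- All catalysts have their initial reduced states in the global state `M`. -/
def HasCatMarginals (D : Dilation β HS n) (M : Matrix (S × D.Env) (S × D.Env) ℂ) : Prop :=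
  ∀ i, siteMarginal i (traceFst (traceFst M)) = D.η i

theorem returnsCatalysts_iff (D : Dilation β HS n) (ρ : Matrix S S ℂ) :
    D.ReturnsCatalysts ρ ↔ D.HasCatMarginals (D.globalOut ρ) := by
  simp only [ReturnsCatalysts, HasCatMarginals, traceFst_sysCatOut]

theorem hasCatMarginals_kronecker (D : Dilation β HS n) {ρ : Matrix S S ℂ} (hρ : ρ.trace = 1) :
    D.HasCatMarginals (ρ ⊗ₖ D.envState) := fun i => by
  rw [traceFst_kronecker, hρ, one_smul, envState, traceFst_kronecker,
    (isState_gibbs β D.hermB).2, one_smul, catState, siteMarginal_piTensor i fun i => (D.stateC i).2]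

theorem trace_mul_totalEnergy (D : Dilation β HS n) (M : Matrix (S × D.Env) (S × D.Env) ℂ) :
    (M * D.totalEnergy).trace = (traceSnd M * HS).trace + ((traceSnd (traceFst M) * D.HB).trace +
      ∑ i, (siteMarginal i (traceFst (traceFst M)) * D.HC i).trace) := by
  rw [totalEnergy, Matrix.mul_add, Matrix.trace_add, trace_mul_kronecker_one,
    trace_mul_one_kronecker, Matrix.mul_add, Matrix.trace_add, trace_mul_kronecker_one,
    trace_mul_one_kronecker, Matrix.mul_sum, Matrix.trace_sum]
  simp only [trace_mul_atSite]

theorem ker_envState_le (D : Dilation β HS n) {M : Matrix (S × D.Env) (S × D.Env) ℂ}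
    (hM : M.PosSemidef) (hret : D.HasCatMarginals M) :
    LinearMap.ker D.envState.mulVecLin ≤ LinearMap.ker (traceFst M).mulVecLin :=
  ker_kronecker_le (posSemidef_traceFst hM) (posDef_gibbs β D.hermB).1 D.isState_catState.1.1
    (ker_le_of_posDef (posDef_gibbs β D.hermB))
    (ker_piTensor_le (posSemidef_traceFst (posSemidef_traceFst hM)) (fun i => (D.stateC i).1.1)
      hret)

/-- On states with the prescribed catalyst marginals, `Tr[M log(τ_S ⊗ ρ_E)]` is an affine function
of the total energy. -/
theorem exists_trace_mul_mlog_eq [Nonempty S] (hHS : HS.IsHermitian) (D : Dilation β HS n) :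
    ∃ c : ℂ, ∀ M : Matrix (S × D.Env) (S × D.Env) ℂ, IsState M → D.HasCatMarginals M →
      (traceSnd M * mlog (gibbs β HS)).trace + (traceFst M * mlog D.envState).trace =
        -β * (M * D.totalEnergy).trace + c := by
  obtain ⟨zS, hzS⟩ := exists_mlog_gibbs β hHS
  obtain ⟨zB, hzB⟩ := exists_mlog_gibbs β D.hermB
  -- The constant collects the log-normalisations of the two Gibbs states, the terms `Tr[η log η]`
  -- of the catalysts, and the catalyst energies. The last two are fixed by the prescribed
  -- marginals; the energies are added back because `totalEnergy` includes them.
  refine ⟨zS + zB + ∑ i, (D.η i * mlog (D.η i)).trace + β * ∑ i, (D.η i * D.HC i).trace,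
    fun M hM hret => ?_⟩
  have hE : (traceFst M * mlog D.envState).trace =
      (traceSnd (traceFst M) * mlog (gibbs β D.HB)).trace +
        ∑ i, (D.η i * mlog (D.η i)).trace := by
    rw [envState, trace_mul_mlog_kronecker (posSemidef_traceFst hM.1)
      (posDef_gibbs β D.hermB).1 D.isState_catState.1.1
      (ker_le_of_posDef (posDef_gibbs β D.hermB))
      (ker_piTensor_le (posSemidef_traceFst (posSemidef_traceFst hM.1))
        (fun i => (D.stateC i).1.1) hret), catState,
      trace_mul_mlog_piTensor (posSemidef_traceFst (posSemidef_traceFst hM.1))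
        (fun i => (D.stateC i).1.1) hret]
  have hC : ∑ i, (siteMarginal i (traceFst (traceFst M)) * D.HC i).trace =
      ∑ i, (D.η i * D.HC i).trace := Finset.sum_congr rfl fun i _ => by
    have h : siteMarginal i (traceFst (traceFst M)) = D.η i := hret i
    rw [h]
  rw [hE, trace_mul_totalEnergy, hzS, hzB, hC]
  simp only [Matrix.mul_add, Matrix.mul_smul, Matrix.trace_add,
    Matrix.trace_smul, Matrix.mul_one, trace_traceSnd, trace_traceFst, hM.2, smul_eq_mul]
  ring

theorem trace_globalOut_mul_totalEnergy (D : Dilation β HS n) (ρ : Matrix S S ℂ) :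
    (D.globalOut ρ * D.totalEnergy).trace = ((ρ ⊗ₖ D.envState) * D.totalEnergy).trace := by
  have h : D.U * D.totalEnergy = D.totalEnergy * D.U := D.energy
  rw [globalOut, Matrix.mul_assoc, Matrix.mul_assoc, Matrix.trace_mul_comm, Matrix.mul_assoc,
    Matrix.mul_assoc, ← h, ← Matrix.mul_assoc D.Uᴴ, conjTranspose_mul_self_of_mem D.unitary,
    Matrix.one_mul]

/-- The affine energy formula applies both before and after the interaction, with the same constant,
and energy conservation equates the two. -/
theorem balance_of_returns [Nonempty S] (hHS : HS.IsHermitian) (D : Dilation β HS n)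
    {ρ : Matrix S S ℂ} (hρ : IsState ρ) (hret : D.ReturnsCatalysts ρ) :
    (D.channel ρ * mlog (gibbs β HS)).trace +
        (traceFst (D.globalOut ρ) * mlog D.envState).trace =
      (ρ * mlog (gibbs β HS)).trace + (D.envState * mlog D.envState).trace := by
  obtain ⟨c, hc⟩ := exists_trace_mul_mlog_eq hHS D
  have h1 := hc _ (D.isState_globalOut hρ) ((D.returnsCatalysts_iff ρ).mp hret)
  have h2 := hc _ (hρ.kronecker D.isState_envState) (D.hasCatMarginals_kronecker hρ.2)
  rw [trace_globalOut_mul_totalEnergy, ← h2, traceSnd_kronecker, traceFst_kronecker, hρ.2,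
    D.isState_envState.2, one_smul, one_smul] at h1
  exact h1

/-- Isolates what the inequality really uses: a support condition and the balance identity. Each of
the two return hypotheses supplies both. -/
theorem relEntropy_recovery_le [Nonempty S] (hHS : HS.IsHermitian) (D : Dilation β HS n)
    {ρ : Matrix S S ℂ} (hρ : IsState ρ)
    (hker : LinearMap.ker D.envState.mulVecLin ≤
      LinearMap.ker (traceFst (D.globalOut ρ)).mulVecLin)
    (hbal : (D.channel ρ * mlog (gibbs β HS)).trace +
        (traceFst (D.globalOut ρ) * mlog D.envState).trace =
      (ρ * mlog (gibbs β HS)).trace + (D.envState * mlog D.envState).trace) :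
    relEntropy ρ (D.recovery (D.channel ρ)) ≤
      relEntropy ρ (gibbs β HS) - relEntropy (D.channel ρ) (gibbs β HS) := by
  have hω := D.isState_globalOut hρ
  have hE := D.isState_envState
  have hT : IsState (D.channel ρ) := hω.traceSnd
  have hP : (D.channel ρ ⊗ₖ D.envState).PosSemidef := hT.1.kronecker hE.1
  set K : Matrix (S × D.Env) (S × D.Env) ℂ := D.Uᴴ * (D.channel ρ ⊗ₖ D.envState) * D.U with hK
  have hKp : K.PosSemidef := hP.conjTranspose_mul_mul_same D.U
  have hkerω : LinearMap.ker (D.channel ρ ⊗ₖ D.envState).mulVecLin ≤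
      LinearMap.ker (D.globalOut ρ).mulVecLin :=
    ker_kronecker_le hω.1 hT.1.1 hE.1.1 le_rfl hker
  have hUU := conjTranspose_mul_self_of_mem D.unitary
  have hUU' := mul_conjTranspose_self_of_mem D.unitary
  have hback : D.Uᴴ * D.globalOut ρ * D.U = ρ ⊗ₖ D.envState := by
    calc D.Uᴴ * D.globalOut ρ * D.U
        = (D.Uᴴ * D.U) * (ρ ⊗ₖ D.envState) * (D.Uᴴ * D.U) := by
          simp only [globalOut, Matrix.mul_assoc]
      _ = _ := by rw [hUU, Matrix.one_mul, Matrix.mul_one]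
  -- Conjugating by `U` carries this to the support inclusion between the joint output and the
  -- product of `D.channel ρ` with the environment state.
  have hkerK : LinearMap.ker K.mulVecLin ≤ LinearMap.ker (ρ ⊗ₖ D.envState).mulVecLin := by
    intro x hx
    rw [LinearMap.mem_ker, mulVecLin_apply] at hx ⊢
    have h1 : (D.channel ρ ⊗ₖ D.envState) *ᵥ (D.U *ᵥ x) = 0 := by
      have h2 := congrArg (D.U *ᵥ ·) hx
      simpa only [hK, mulVec_mulVec, ← Matrix.mul_assoc, hUU', Matrix.one_mul, mulVec_zero]
        using h2
    have h3 : D.globalOut ρ *ᵥ (D.U *ᵥ x) = 0 := hkerω h1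
    rw [← hback, ← mulVec_mulVec, ← mulVec_mulVec, h3, mulVec_zero]
  have hkerR : LinearMap.ker (D.recovery (D.channel ρ)).mulVecLin ≤ LinearMap.ker ρ.mulVecLin :=
    ker_traceSnd_le hρ.1 hE.2 hKp hkerK
  have hmain := trace_kronecker_mul_mlog_le hρ hE hKp hkerK
  have hlogK : mlog K = D.Uᴴ * mlog (D.channel ρ ⊗ₖ D.envState) * D.U := by
    simpa using mlog_conj hP.1 (conjTranspose_mem_unitaryGroup D.unitary)
  have htr : ((ρ ⊗ₖ D.envState) * mlog K).trace =
      (D.channel ρ * mlog (D.channel ρ)).trace +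
        (traceFst (D.globalOut ρ) * mlog D.envState).trace := by
    have h1 : ((ρ ⊗ₖ D.envState) * mlog K).trace =
        (D.globalOut ρ * mlog (D.channel ρ ⊗ₖ D.envState)).trace := by
      rw [hlogK, globalOut, ← Matrix.mul_assoc, Matrix.trace_mul_comm]
      simp only [Matrix.mul_assoc]
    rw [h1, trace_mul_mlog_kronecker hω.1 hT.1.1 hE.1.1 le_rfl hker]
    rfl
  rw [htr] at hmain
  have hτ : ∀ A : Matrix S S ℂ, LinearMap.ker (gibbs β HS).mulVecLin ≤ LinearMap.ker A.mulVecLin :=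
    fun A => ker_le_of_posDef (posDef_gibbs β hHS)
  rw [relEntropy, relEntropy, relEntropy, if_pos hkerR, if_pos (hτ _), if_pos (hτ _),
    ← EReal.coe_sub, EReal.coe_le_coe_iff]
  have hbal' := congrArg Complex.re hbal
  change _ ≤ (ρ * mlog (D.recovery (D.channel ρ))).trace.re at hmain
  simp only [Complex.add_re, Complex.sub_re] at hbal' hmain ⊢
  linarith

end Dilation

/-! ### The equality case of Klein's inequality. -/

section Invariance

variable {ι : Type*} [Fintype ι] [DecidableEq ι]

/-- The Bregman divergence of `x log x`, from `log u ≤ u - 1` at `u = y / x`; at `x = 0` it is just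
`y`. -/
theorem mul_log_sub_nonneg {x y : ℝ} (hx : 0 ≤ x) (hy : 0 < y) :
    0 ≤ x * Real.log x - x * Real.log y - x + y := by
  rcases hx.eq_or_lt with rfl | hx
  · simpa using hy.le
  · have h := Real.log_le_sub_one_of_pos (div_pos hy hx)
    rw [Real.log_div hy.ne' hx.ne'] at h
    have h2 := mul_le_mul_of_nonneg_left h hx.le
    have h3 : x * (y / x - 1) = y - x := by field_simp
    rw [h3] at h2
    linarith

theorem eq_of_mul_log_sub_eq_zero {x y : ℝ} (hx : 0 ≤ x) (hy : 0 < y)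
    (h : x * Real.log x - x * Real.log y - x + y = 0) : x = y := by
  rcases hx.eq_or_lt with rfl | hx
  · simp at h; linarith
  · by_contra hne
    have h1 : y / x ≠ 1 := fun h1 => hne ((div_eq_one_iff_eq hx.ne').mp h1).symm
    have h0 := Real.log_lt_sub_one_of_pos (div_pos hy hx) h1
    rw [Real.log_div hy.ne' hx.ne'] at h0
    have h2 := mul_lt_mul_of_pos_left h0 hx
    have h3 : x * (y / x - 1) = y - x := by field_simp
    rw [h3] at h2
    linarith

/-- A unitary that preserves `Tr[σ log σ]` (with the logarithm kept fixed) only connects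
eigenvectors of `σ` with the same eigenvalue. -/
theorem eigenvalue_eq_of_trace_mul_mlog_eq {W U : Matrix ι ι ℂ} (hW : W ∈ unitaryGroup ι ℂ)
    (hU : U ∈ unitaryGroup ι ℂ) {d : ι → ℝ} (hd : ∀ i, 0 ≤ d i)
    (hker : LinearMap.ker (conjDiag W d).mulVecLin ≤
      LinearMap.ker (U * conjDiag W d * Uᴴ).mulVecLin)
    (h : (U * conjDiag W d * Uᴴ * mlog (conjDiag W d)).trace =
      (conjDiag W d * mlog (conjDiag W d)).trace) (j k : ι) (hjk : (Wᴴ * U * W) j k ≠ 0) :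
    d j = d k := by
  set X := Wᴴ * U * W with hX
  have hXu : X ∈ unitaryGroup ι ℂ :=
    mul_mem (mul_mem (conjTranspose_mem_unitaryGroup hW) hU) hW
  -- The squared moduli of the unitary `X` form a doubly stochastic matrix.
  let P : ι → ι → ℝ := fun j k => Complex.normSq (X j k)
  have hP0 : ∀ j k, 0 ≤ P j k := fun j k => Complex.normSq_nonneg _
  have hrow : ∀ j, ∑ k, P j k = 1 := fun j => by
    have h1 := congrFun (congrFun (mul_conjTranspose_self_of_mem hXu) j) j
    rw [Matrix.mul_apply, one_apply_eq] at h1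
    have h2 : ((∑ k, P j k : ℝ) : ℂ) = 1 := by
      rw [← h1, Complex.ofReal_sum]
      exact Finset.sum_congr rfl fun k _ => by
        rw [conjTranspose_apply]; exact (Complex.mul_conj _).symm
    exact_mod_cast h2
  have hcol : ∀ k, ∑ j, P j k = 1 := fun k => by
    have h1 := congrFun (congrFun (conjTranspose_mul_self_of_mem hXu) k) k
    rw [Matrix.mul_apply, one_apply_eq] at h1
    have h2 : ((∑ j, P j k : ℝ) : ℂ) = 1 := by
      rw [← h1, Complex.ofReal_sum]
      exact Finset.sum_congr rfl fun j _ => by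
        rw [conjTranspose_apply, mul_comm]; exact (Complex.mul_conj _).symm
    exact_mod_cast h2
  have hdiag : ∀ j, (Wᴴ * (U * conjDiag W d * Uᴴ) * W) j j = ((∑ k, P j k * d k : ℝ) : ℂ) := by
    intro j
    have h1 : Wᴴ * (U * conjDiag W d * Uᴴ) * W = X * diagonal (fun i => (d i : ℂ)) * Xᴴ := by
      simp only [hX, conjDiag, conjTranspose_mul, conjTranspose_conjTranspose, Matrix.mul_assoc]
    rw [h1, Matrix.mul_apply, Complex.ofReal_sum]
    refine Finset.sum_congr rfl fun k _ => ?_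
    rw [mul_diagonal, conjTranspose_apply, mul_right_comm]
    have : X j k * star (X j k) = (P j k : ℂ) := Complex.mul_conj _
    rw [this, Complex.ofReal_mul]
  -- At `d j = 0` the scalar inequality is unavailable; the support hypothesis removes every such
  -- term instead.
  have hsupp : ∀ j, d j = 0 → ∀ k, P j k * d k = 0 := fun j hj k => by
    have h1 := apply_diag_eq_zero_of_ker_le hW hker hj
    rw [hdiag] at h1
    exact (Finset.sum_eq_zero_iff_of_nonneg fun k _ => mul_nonneg (hP0 j k) (hd k)).mp
      (by exact_mod_cast h1) k (Finset.mem_univ k)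
  have hent : ∑ j, ∑ k, P j k * d k * Real.log (d j) = ∑ k, d k * Real.log (d k) := by
    have h1 := congrArg Complex.re h
    rw [trace_mul_mlog_conjDiag hW, trace_mul_mlog_conjDiag hW, conj_conjDiag_self hW] at h1
    simp only [hdiag, Complex.ofReal_re, diagonal_apply_eq, Finset.sum_mul] at h1
    exact h1
  -- Klein's integrand weighted by `P`. The linear terms cancel by double stochasticity and the
  -- entropy terms by `hent`, so nonnegative numbers sum to zero and each vanishes.
  let t : ι → ι → ℝ := fun j k =>
    P j k * (d k * Real.log (d k) - d k * Real.log (d j) - d k + d j)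
  have ht0 : ∀ j k, 0 ≤ t j k := fun j k => by
    rcases (hd j).eq_or_lt with hj | hj
    · have := hsupp j hj.symm k
      have h2 : t j k = P j k * d k * (Real.log (d k) - 1) := by
        simp only [t, ← hj, Real.log_zero]; ring
      rw [h2, this, zero_mul]
    · exact mul_nonneg (hP0 j k) (mul_log_sub_nonneg (hd k) hj)
  have hsum : ∑ j, ∑ k, t j k = 0 := by
    have h1 : ∀ f : ι → ℝ, ∑ j, ∑ k, P j k * f k = ∑ k, f k := fun f => by
      rw [Finset.sum_comm]
      exact Finset.sum_congr rfl fun k _ => by rw [← Finset.sum_mul, hcol, one_mul]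
    have h2 : ∑ j, ∑ k, P j k * d j = ∑ j, d j :=
      Finset.sum_congr rfl fun j _ => by rw [← Finset.sum_mul, hrow, one_mul]
    have h3 : ∑ j, ∑ k, t j k = ∑ j, ∑ k, P j k * (d k * Real.log (d k))
        - ∑ j, ∑ k, P j k * d k * Real.log (d j) - ∑ j, ∑ k, P j k * d k
        + ∑ j, ∑ k, P j k * d j := by
      simp only [← Finset.sum_sub_distrib, ← Finset.sum_add_distrib, t]
      exact Finset.sum_congr rfl fun j _ => Finset.sum_congr rfl fun k _ => by ring
    rw [h3, h1, h1, h2, hent]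
    ring
  have hjk0 : t j k = 0 := by
    have h1 := (Finset.sum_eq_zero_iff_of_nonneg fun j _ =>
      Finset.sum_nonneg fun k _ => ht0 j k).mp hsum j (Finset.mem_univ j)
    exact (Finset.sum_eq_zero_iff_of_nonneg fun k _ => ht0 j k).mp h1 k (Finset.mem_univ k)
  have hPjk : P j k ≠ 0 := fun h0 => hjk (Complex.normSq_eq_zero.mp h0)
  rcases (hd j).eq_or_lt with hj | hj
  · have h1 := hsupp j hj.symm k
    rw [← hj]
    exact ((mul_eq_zero.mp h1).resolve_left hPjk).symm
  · exact (eq_of_mul_log_sub_eq_zero (hd k) hj ((mul_eq_zero.mp hjk0).resolve_left hPjk)).symm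

/-- In the basis `W` the commutator has entries `(g k - g j) * X j k` with `X = Wᴴ * U * W`. Here
`g` need not be a function of a given spectrum, which is used for square roots, support projections
and Hamiltonians. -/
theorem commute_conjDiag {W U : Matrix ι ι ℂ} (hW : W ∈ unitaryGroup ι ℂ) {g : ι → ℝ}
    (h : ∀ j k, (Wᴴ * U * W) j k ≠ 0 → g j = g k) : Commute U (conjDiag W g) := by
  have hWW := mul_conjTranspose_self_of_mem hW
  have h1 : (Wᴴ * U * W) * diagonal (fun i => (g i : ℂ)) =
      diagonal (fun i => (g i : ℂ)) * (Wᴴ * U * W) := by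
    ext j k
    rw [mul_diagonal, diagonal_mul, mul_comm]
    by_cases hjk : (Wᴴ * U * W) j k = 0
    · rw [hjk, mul_zero, mul_zero]
    · rw [h j k hjk]
  calc U * conjDiag W g
      = (W * Wᴴ) * U * conjDiag W g := by rw [hWW, Matrix.one_mul]
    _ = W * ((Wᴴ * U * W) * diagonal (fun i => (g i : ℂ))) * Wᴴ := by
        simp only [conjDiag, Matrix.mul_assoc]
    _ = conjDiag W g * U * (W * Wᴴ) := by rw [h1]; simp only [conjDiag, Matrix.mul_assoc]
    _ = conjDiag W g * U := by rw [hWW, Matrix.mul_one]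

end Invariance

/-! ### Invariance of the thermal product state and the Petz map. -/

namespace Dilation

variable {S : Type*} [Fintype S] [DecidableEq S] {β : ℝ} {HS : Matrix S S ℂ} {n : ℕ}

/-- The balance on the thermal input makes `Tr[UσU† log σ] = Tr[σ log σ]` for `σ` the Gibbs state
tensored with `D.envState`, and Klein's equality case applies. The eigenbases stay arbitrary so that
later constructions can choose them. -/
theorem eigenvalue_eq_of_returns [Nonempty S] (hHS : HS.IsHermitian) (D : Dilation β HS n)
    (hret : D.ReturnsCatalysts (gibbs β HS)) {W : Matrix S S ℂ} (hW : W ∈ unitaryGroup S ℂ)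
    {a : S → ℝ} (hWa : gibbs β HS = conjDiag W a) {V : Matrix D.Env D.Env ℂ}
    (hV : V ∈ unitaryGroup D.Env ℂ) {r : D.Env → ℝ} (hVr : D.envState = conjDiag V r)
    (j k : S × D.Env) (hjk : ((W ⊗ₖ V)ᴴ * D.U * (W ⊗ₖ V)) j k ≠ 0) :
    a j.1 * r j.2 = a k.1 * r k.2 := by
  have hτ := isState_gibbs β hHS
  have hτp := posDef_gibbs β hHS
  have hE := D.isState_envState
  have hω := D.isState_globalOut hτ
  have hkerE := D.ker_envState_le hω.1 ((D.returnsCatalysts_iff _).mp hret)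
  have hker := ker_kronecker_le hω.1 hτp.1 hE.1.1 (ker_le_of_posDef hτp) hkerE
  have h1 := trace_mul_mlog_kronecker hω.1 hτp.1 hE.1.1 (ker_le_of_posDef hτp) hkerE
  have hσ := hτ.kronecker hE
  have h2 := trace_mul_mlog_kronecker hσ.1 hτp.1 hE.1.1 (ker_le_of_posDef hτp)
    (by rw [traceFst_kronecker, hτ.2, one_smul])
  rw [traceSnd_kronecker, traceFst_kronecker, hτ.2, hE.2, one_smul, one_smul,
    ← D.balance_of_returns hHS hτ hret] at h2
  have h3 := h1.trans h2.symm
  have hσd : gibbs β HS ⊗ₖ D.envState = conjDiag (W ⊗ₖ V) fun x => a x.1 * r x.2 := by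
    rw [hWa, hVr, kronecker_conjDiag]
  rw [globalOut, hσd] at h3 hker
  refine eigenvalue_eq_of_trace_mul_mlog_eq (kronecker_mem_unitaryGroup hW hV) D.unitary
    (fun x => ?_) hker h3 j k hjk
  exact nonneg_of_posSemidef_conjDiag (kronecker_mem_unitaryGroup hW hV) (hσd ▸ hσ.1) x

theorem commute_kronecker_envState [Nonempty S] (hHS : HS.IsHermitian) (D : Dilation β HS n)
    (hret : D.ReturnsCatalysts (gibbs β HS)) : Commute D.U (gibbs β HS ⊗ₖ D.envState) := by
  obtain ⟨W, hW, a, hWa⟩ := exists_conjDiag (posDef_gibbs β hHS).1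
  obtain ⟨V, hV, r, hVr⟩ := exists_conjDiag D.isState_envState.1.1
  rw [hWa, hVr, kronecker_conjDiag]
  exact commute_conjDiag (kronecker_mem_unitaryGroup hW hV)
    (D.eigenvalue_eq_of_returns hHS hret hW hWa hV hVr)

theorem commute_kronecker_msqrt [Nonempty S] (hHS : HS.IsHermitian) (D : Dilation β HS n)
    (hret : D.ReturnsCatalysts (gibbs β HS)) :
    Commute D.U (msqrt (gibbs β HS) ⊗ₖ msqrt D.envState) := by
  obtain ⟨W, hW, a, hWa⟩ := exists_conjDiag (posDef_gibbs β hHS).1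
  obtain ⟨V, hV, r, hVr⟩ := exists_conjDiag D.isState_envState.1.1
  have ha : ∀ i, 0 ≤ a i :=
    nonneg_of_posSemidef_conjDiag hW (hWa ▸ (posDef_gibbs β hHS).posSemidef)
  rw [hWa, hVr, msqrt, msqrt, cfc_conjDiag hW, cfc_conjDiag hV, kronecker_conjDiag]
  refine commute_conjDiag (kronecker_mem_unitaryGroup hW hV) fun j k hjk => ?_
  have h := D.eigenvalue_eq_of_returns hHS hret hW hWa hV hVr j k hjk
  rw [← Real.sqrt_mul (ha _), ← Real.sqrt_mul (ha _), h]

theorem globalOut_gibbs [Nonempty S] (hHS : HS.IsHermitian) (D : Dilation β HS n)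
    (hret : D.ReturnsCatalysts (gibbs β HS)) :
    D.globalOut (gibbs β HS) = gibbs β HS ⊗ₖ D.envState := by
  rw [globalOut, (D.commute_kronecker_envState hHS hret).eq, Matrix.mul_assoc,
    mul_conjTranspose_self_of_mem D.unitary, Matrix.mul_one]

theorem channel_gibbs [Nonempty S] (hHS : HS.IsHermitian) (D : Dilation β HS n)
    (hret : D.ReturnsCatalysts (gibbs β HS)) : D.channel (gibbs β HS) = gibbs β HS := by
  change traceSnd (D.globalOut _) = _
  rw [D.globalOut_gibbs hHS hret, traceSnd_kronecker, D.isState_envState.2, one_smul]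

theorem reverse_globalOut_gibbs [Nonempty S] (hHS : HS.IsHermitian) (D : Dilation β HS n)
    (hret : D.ReturnsCatalysts (gibbs β HS)) :
    D.reverse.globalOut (gibbs β HS) = gibbs β HS ⊗ₖ D.envState := by
  change D.Uᴴ * (gibbs β HS ⊗ₖ D.envState) * D.Uᴴᴴ = _
  rw [conjTranspose_conjTranspose, Matrix.mul_assoc,
    ← (D.commute_kronecker_envState hHS hret).eq, ← Matrix.mul_assoc,
    conjTranspose_mul_self_of_mem D.unitary, Matrix.one_mul]

theorem reverse_channel (D : Dilation β HS n) (X : Matrix S S ℂ) :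
    D.reverse.channel X = D.recovery X := by
  change traceSnd (D.Uᴴ * (X ⊗ₖ D.envState) * D.Uᴴᴴ) = _
  rw [conjTranspose_conjTranspose]
  rfl

theorem reverse_returnsCatalysts_gibbs [Nonempty S] (hHS : HS.IsHermitian) (D : Dilation β HS n)
    (hret : D.ReturnsCatalysts (gibbs β HS)) : D.reverse.ReturnsCatalysts (gibbs β HS) := by
  rw [returnsCatalysts_iff, D.reverse_globalOut_gibbs hHS hret]
  exact D.hasCatMarginals_kronecker (isState_gibbs β hHS).2

/-- Conjugation by `U` fixes `σ`, hence `log σ`, so `Tr[· log σ]` is the same before and after the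
interaction. Splitting the logarithm on both sides gives the balance without any return of the
catalysts on `ρ`. -/
theorem balance_of_returns_gibbs [Nonempty S] (hHS : HS.IsHermitian) (D : Dilation β HS n)
    (hret : D.ReturnsCatalysts (gibbs β HS)) {ρ : Matrix S S ℂ} (hρ : IsState ρ) :
    LinearMap.ker D.envState.mulVecLin ≤ LinearMap.ker (traceFst (D.globalOut ρ)).mulVecLin ∧
    (D.channel ρ * mlog (gibbs β HS)).trace +
        (traceFst (D.globalOut ρ) * mlog D.envState).trace =
      (ρ * mlog (gibbs β HS)).trace + (D.envState * mlog D.envState).trace := by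
  have hτp := posDef_gibbs β hHS
  have hE := D.isState_envState
  have hω := D.isState_globalOut hρ
  have hρE := hρ.kronecker hE
  set σ := gibbs β HS ⊗ₖ D.envState with hσ
  have hσh : σ.IsHermitian := ((isState_gibbs β hHS).kronecker hE).1.1
  have hcomm : D.U * σ = σ * D.U := D.commute_kronecker_envState hHS hret
  have hUU := conjTranspose_mul_self_of_mem D.unitary
  have hUU' := mul_conjTranspose_self_of_mem D.unitary
  have hconj : D.Uᴴ * σ * D.U = σ := by
    rw [Matrix.mul_assoc, ← hcomm, ← Matrix.mul_assoc, hUU, Matrix.one_mul]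
  have hfst : LinearMap.ker D.envState.mulVecLin ≤
      LinearMap.ker (traceFst (ρ ⊗ₖ D.envState)).mulVecLin := by
    rw [traceFst_kronecker, hρ.2, one_smul]
  have hker1 : LinearMap.ker σ.mulVecLin ≤ LinearMap.ker (ρ ⊗ₖ D.envState).mulVecLin :=
    ker_kronecker_le hρE.1 hτp.1 hE.1.1 (ker_le_of_posDef hτp) hfst
  have hker2 : LinearMap.ker σ.mulVecLin ≤ LinearMap.ker (D.globalOut ρ).mulVecLin := by
    intro x hx
    rw [LinearMap.mem_ker, mulVecLin_apply] at hx ⊢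
    have h1 : σ *ᵥ (D.Uᴴ *ᵥ x) = 0 := by
      have h2 : σ * D.Uᴴ = D.Uᴴ * σ := by
        rw [← hconj, Matrix.mul_assoc (D.Uᴴ * σ), hUU', Matrix.mul_one, hconj]
      rw [mulVec_mulVec, h2, ← mulVec_mulVec, hx, mulVec_zero]
    have h3 : (ρ ⊗ₖ D.envState) *ᵥ (D.Uᴴ *ᵥ x) = 0 := hker1 h1
    rw [globalOut, ← mulVec_mulVec, ← mulVec_mulVec, h3, mulVec_zero]
  have hkerE := ker_traceFst_le hker2
  refine ⟨hkerE, ?_⟩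
  have h1 := trace_mul_mlog_kronecker hω.1 hτp.1 hE.1.1 (ker_le_of_posDef hτp) hkerE
  have h2 := trace_mul_mlog_kronecker hρE.1 hτp.1 hE.1.1 (ker_le_of_posDef hτp) hfst
  rw [traceSnd_kronecker, traceFst_kronecker, hρ.2, hE.2, one_smul, one_smul] at h2
  have hlog : D.Uᴴ * mlog σ * D.U = mlog σ := by
    have h := mlog_conj hσh (conjTranspose_mem_unitaryGroup D.unitary)
    rw [conjTranspose_conjTranspose, hconj] at h
    exact h.symm
  refine h1.symm.trans (Eq.trans ?_ h2)
  change (D.globalOut ρ * mlog σ).trace = ((ρ ⊗ₖ D.envState) * mlog σ).trace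
  conv_rhs => rw [← hlog, ← Matrix.mul_assoc, Matrix.trace_mul_comm]
  rw [globalOut]
  simp only [Matrix.mul_assoc]

/-- The Heisenberg picture: cyclicity of the trace moves the unitaries onto the observable, and
matrix units read off the entries. -/
theorem hsAdjoint_channel (D : Dilation β HS n) (Y : Matrix S S ℂ) :
    hsAdjoint D.channel Y = traceSnd (D.Uᴴ * (Y ⊗ₖ (1 : Matrix D.Env D.Env ℂ)) * D.U *
      ((1 : Matrix S S ℂ) ⊗ₖ D.envState)) := by
  set G := D.Uᴴ * (Y ⊗ₖ (1 : Matrix D.Env D.Env ℂ)) * D.U with hG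
  have hEh : D.envStateᴴ = D.envState := D.isState_envState.1.1
  ext i j
  have h1 : (D.channel (Matrix.single i j 1))ᴴ =
      traceSnd (D.U * (Matrix.single j i 1 ⊗ₖ D.envState) * D.Uᴴ) := by
    change (traceSnd (D.globalOut _))ᴴ = _
    rw [← traceSnd_conjTranspose, globalOut, conjTranspose_mul, conjTranspose_mul,
      conjTranspose_conjTranspose, conjTranspose_kronecker, hEh, conjTranspose_single, star_one,
      Matrix.mul_assoc]
  have h2 : Matrix.single j i 1 ⊗ₖ D.envState =
      ((1 : Matrix S S ℂ) ⊗ₖ D.envState) * (Matrix.single j i 1 ⊗ₖ (1 : Matrix D.Env D.Env ℂ)) := by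
    rw [← mul_kronecker_mul, Matrix.one_mul, Matrix.mul_one]
  have h3 : ((D.channel (Matrix.single i j 1))ᴴ * Y).trace =
      (G * ((1 : Matrix S S ℂ) ⊗ₖ D.envState) *
        (Matrix.single j i 1 ⊗ₖ (1 : Matrix D.Env D.Env ℂ))).trace := by
    rw [h1, ← trace_mul_kronecker_one, h2, Matrix.mul_assoc, Matrix.mul_assoc,
      Matrix.trace_mul_comm, Matrix.mul_assoc, Matrix.trace_mul_comm (((1 : Matrix S S ℂ) ⊗ₖ _) * _)]
    rw [hG]
    simp only [Matrix.mul_assoc]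
  rw [trace_mul_kronecker_one] at h3
  refine h3.trans ?_
  simp [Matrix.trace_mul_single]

theorem msqrt_mul_msqrt {ι : Type*} [Fintype ι] [DecidableEq ι] {A : Matrix ι ι ℂ}
    (hA : A.PosSemidef) : msqrt A * msqrt A = A := by
  obtain ⟨W, hW, a, rfl⟩ := exists_conjDiag hA.1
  rw [msqrt, cfc_conjDiag hW, conjDiag_mul hW]
  congr 1
  funext i
  exact Real.mul_self_sqrt (nonneg_of_posSemidef_conjDiag hW hA i)

theorem msqrt_mul_minvsqrt {ι : Type*} [Fintype ι] [DecidableEq ι] {A : Matrix ι ι ℂ}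
    (hA : A.PosDef) : msqrt A * minvsqrt A = 1 ∧ minvsqrt A * msqrt A = 1 := by
  obtain ⟨W, hW, a, rfl⟩ := exists_conjDiag hA.1
  have ha : ∀ i, a i ≠ 0 := fun i h0 => by
    have h := posDef_conj hA (conjTranspose_mem_unitaryGroup hW)
    rw [conjTranspose_conjTranspose, conj_conjDiag_self hW] at h
    have := posDef_diagonal_iff.mp h i
    simp [h0] at this
  have hs : ∀ i, √(a i) ≠ 0 := fun i => by
    have := nonneg_of_posSemidef_conjDiag hW hA.posSemidef i
    exact (Real.sqrt_pos.mpr (lt_of_le_of_ne this (ha i).symm)).ne'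
  have h1 : conjDiag W (fun _ => 1) = 1 := by simpa using conjDiag_const hW 1
  rw [msqrt, minvsqrt, cfc_conjDiag hW, cfc_conjDiag hW, conjDiag_mul hW, conjDiag_mul hW, ← h1]
  constructor <;> congr 1 <;> funext i
  · exact mul_inv_cancel₀ (hs i)
  · exact inv_mul_cancel₀ (hs i)

theorem recovery_eq_petz [Nonempty S] (hHS : HS.IsHermitian) (D : Dilation β HS n)
    (hret : D.ReturnsCatalysts (gibbs β HS)) (X : Matrix S S ℂ) :
    D.recovery X = petz D.channel (gibbs β HS) X := by
  obtain ⟨hsi, his⟩ := msqrt_mul_minvsqrt (posDef_gibbs β hHS)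
  have hEE := msqrt_mul_msqrt D.isState_envState.1
  have hcomm : D.U * (msqrt (gibbs β HS) ⊗ₖ msqrt D.envState) =
      (msqrt (gibbs β HS) ⊗ₖ msqrt D.envState) * D.U := D.commute_kronecker_msqrt hHS hret
  have hUU := conjTranspose_mul_self_of_mem D.unitary
  have hUU' := mul_conjTranspose_self_of_mem D.unitary
  rw [petz, D.channel_gibbs hHS hret, hsAdjoint_channel, ← traceSnd_kronecker_one_mul,
    ← traceSnd_mul_kronecker_one]
  set s := msqrt (gibbs β HS)
  set t := minvsqrt (gibbs β HS)
  set q := msqrt D.envState with hq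
  have hcomm' : (s ⊗ₖ q) * D.Uᴴ = D.Uᴴ * (s ⊗ₖ q) := by
    calc (s ⊗ₖ q) * D.Uᴴ = (D.Uᴴ * D.U) * (s ⊗ₖ q) * D.Uᴴ := by rw [hUU, Matrix.one_mul]
      _ = D.Uᴴ * ((s ⊗ₖ q) * D.U) * D.Uᴴ := by rw [← hcomm]; simp only [Matrix.mul_assoc]
      _ = D.Uᴴ * (s ⊗ₖ q) * (D.U * D.Uᴴ) := by simp only [Matrix.mul_assoc]
      _ = D.Uᴴ * (s ⊗ₖ q) := by rw [hUU', Matrix.mul_one]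
  set Y := (t * X * t) ⊗ₖ (1 : Matrix D.Env D.Env ℂ)
  have hE1 : (1 : Matrix S S ℂ) ⊗ₖ D.envState =
      ((1 : Matrix S S ℂ) ⊗ₖ q) * ((1 : Matrix S S ℂ) ⊗ₖ q) := by
    rw [← mul_kronecker_mul, hEE, Matrix.one_mul]
  have hs1 : (s ⊗ₖ (1 : Matrix D.Env D.Env ℂ)) * ((1 : Matrix S S ℂ) ⊗ₖ q) = s ⊗ₖ q := by
    rw [← mul_kronecker_mul, Matrix.one_mul, Matrix.mul_one]
  have hs2 : ((1 : Matrix S S ℂ) ⊗ₖ q) * (s ⊗ₖ (1 : Matrix D.Env D.Env ℂ)) = s ⊗ₖ q := by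
    rw [← mul_kronecker_mul, Matrix.one_mul, Matrix.mul_one]
  have hY : (s ⊗ₖ q) * Y * (s ⊗ₖ q) = X ⊗ₖ D.envState := by
    rw [← mul_kronecker_mul, ← mul_kronecker_mul, Matrix.mul_one, hEE]
    congr 1
    calc s * (t * X * t) * s = (s * t) * X * (t * s) := by simp only [Matrix.mul_assoc]
      _ = X := by rw [hsi, his, Matrix.one_mul, Matrix.mul_one]
  -- Write the environment state as `q * q` and cycle one `q` to the front through the partial
  -- trace. Each `q` joins an `s` to form `s ⊗ₖ q`, which commutes with `D.U` and meets `Y`. Only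
  -- the factor `s` is inverted, so the environment state may be singular.
  symm
  calc traceSnd ((s ⊗ₖ (1 : Matrix D.Env D.Env ℂ)) *
        (D.Uᴴ * Y * D.U * ((1 : Matrix S S ℂ) ⊗ₖ D.envState)) *
        (s ⊗ₖ (1 : Matrix D.Env D.Env ℂ)))
      = traceSnd ((s ⊗ₖ (1 : Matrix D.Env D.Env ℂ)) * D.Uᴴ * Y * D.U *
          (((1 : Matrix S S ℂ) ⊗ₖ q) * (s ⊗ₖ (1 : Matrix D.Env D.Env ℂ))) *
          ((1 : Matrix S S ℂ) ⊗ₖ q)) := by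
        rw [hE1, hs2, ← hs1]
        have hswap : ((1 : Matrix S S ℂ) ⊗ₖ q) * (s ⊗ₖ (1 : Matrix D.Env D.Env ℂ)) =
          (s ⊗ₖ (1 : Matrix D.Env D.Env ℂ)) * ((1 : Matrix S S ℂ) ⊗ₖ q) := by rw [hs1, hs2]
        simp only [Matrix.mul_assoc]
        rw [hswap]
        simp only [← Matrix.mul_assoc]
        rw [Matrix.mul_assoc _ ((1 : Matrix S S ℂ) ⊗ₖ q) (s ⊗ₖ (1 : Matrix D.Env D.Env ℂ)), hswap]
        simp only [← Matrix.mul_assoc]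
    _ = traceSnd ((((1 : Matrix S S ℂ) ⊗ₖ q) * (s ⊗ₖ (1 : Matrix D.Env D.Env ℂ))) *
          D.Uᴴ * Y * D.U * (s ⊗ₖ q)) := by
        rw [← traceSnd_one_kronecker_mul_comm, hs2]
        congr 1
        rw [← hs2]
        simp only [Matrix.mul_assoc]
    _ = traceSnd (D.Uᴴ * ((s ⊗ₖ q) * Y * (s ⊗ₖ q)) * D.U) := by
        rw [hs2, hcomm']
        simp only [Matrix.mul_assoc]
        rw [hcomm]
    _ = D.recovery X := by rw [hY]; rfl

end Dilation

/-! ### Compression of unitaries and Hamiltonians to an invariant subspace. -/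

section Compression

variable {ι κ : Type*} [Fintype ι] [DecidableEq ι] [Fintype κ] [DecidableEq κ]

theorem conj_submatrix (V M : Matrix ι ι ℂ) (f : κ → ι) :
    (V.submatrix id f)ᴴ * M * V.submatrix id f = (Vᴴ * M * V).submatrix f f := by
  ext i j
  simp [Matrix.mul_apply]

theorem conj_submatrix_conjDiag {V : Matrix ι ι ℂ} (hV : V ∈ unitaryGroup ι ℂ) {f : κ → ι}
    (hf : Function.Injective f) (g : ι → ℝ) :
    (V.submatrix id f)ᴴ * conjDiag V g * V.submatrix id f = diagonal fun x => (g (f x) : ℂ) := by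
  rw [conj_submatrix, conj_conjDiag_self hV, submatrix_diagonal _ _ hf]
  rfl

theorem submatrix_conj_diagonal (V : Matrix ι ι ℂ) {f : κ → ι}
    (hf : Function.Injective f) {g : ι → ℝ} (hg : ∀ i, i ∉ Set.range f → g i = 0) :
    V.submatrix id f * (diagonal fun x => (g (f x) : ℂ)) * (V.submatrix id f)ᴴ =
      conjDiag V g := by
  ext i j
  rw [conjDiag, Matrix.mul_apply, Matrix.mul_apply]
  refine Fintype.sum_of_injective f hf _ _ (fun e he => ?_) fun x => ?_
  · rw [mul_diagonal, hg e he, Complex.ofReal_zero, mul_zero, zero_mul]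
  · rw [mul_diagonal, mul_diagonal]
    rfl

/-- Compression of the inverse of a unitary to a subspace with which it commutes. -/
theorem compress_unitary {U : Matrix ι ι ℂ} (hU : U ∈ unitaryGroup ι ℂ) {T : Matrix ι κ ℂ}
    (hT : Tᴴ * T = 1) (hcomm : Commute U (T * Tᴴ)) :
    Uᴴ * T = T * (Tᴴ * Uᴴ * T) ∧ Tᴴ * Uᴴ = (Tᴴ * Uᴴ * T) * Tᴴ ∧
      Tᴴ * Uᴴ * T ∈ unitaryGroup κ ℂ := by
  have h0 : Uᴴ * (T * Tᴴ) = (T * Tᴴ) * Uᴴ := by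
    have h := congrArg conjTranspose hcomm.eq
    simpa only [conjTranspose_mul, conjTranspose_conjTranspose] using h.symm
  have h1 : Uᴴ * T = T * (Tᴴ * Uᴴ * T) := by
    calc Uᴴ * T = Uᴴ * (T * Tᴴ) * T := by rw [Matrix.mul_assoc, Matrix.mul_assoc, hT, Matrix.mul_one]
      _ = T * (Tᴴ * Uᴴ * T) := by rw [h0]; simp only [Matrix.mul_assoc]
  have h2 : Tᴴ * Uᴴ = (Tᴴ * Uᴴ * T) * Tᴴ := by
    calc Tᴴ * Uᴴ = Tᴴ * ((T * Tᴴ) * Uᴴ) := by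
          rw [← Matrix.mul_assoc, ← Matrix.mul_assoc, hT, Matrix.one_mul]
      _ = (Tᴴ * Uᴴ * T) * Tᴴ := by rw [← h0]; simp only [Matrix.mul_assoc]
  refine ⟨h1, h2, ?_⟩
  rw [mem_unitaryGroup_iff, star_eq_conjTranspose]
  calc Tᴴ * Uᴴ * T * (Tᴴ * Uᴴ * T)ᴴ = ((Tᴴ * Uᴴ * T) * Tᴴ) * (U * T) := by
        simp only [conjTranspose_mul, conjTranspose_conjTranspose, Matrix.mul_assoc]
    _ = Tᴴ * (Uᴴ * U) * T := by rw [← h2]; simp only [Matrix.mul_assoc]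
    _ = 1 := by rw [conjTranspose_mul_self_of_mem hU, Matrix.mul_one, hT]

theorem compress_commute {U L : Matrix ι ι ℂ} (hL : Commute U L) (hLh : L.IsHermitian)
    {T : Matrix ι κ ℂ} (h1 : Uᴴ * T = T * (Tᴴ * Uᴴ * T)) (h2 : Tᴴ * Uᴴ = (Tᴴ * Uᴴ * T) * Tᴴ) :
    Commute (Tᴴ * Uᴴ * T) (Tᴴ * L * T) := by
  have h0 : Uᴴ * L = L * Uᴴ := by
    have h := congrArg conjTranspose hL.eq
    rw [conjTranspose_mul, conjTranspose_mul, hLh.eq] at h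
    exact h.symm
  change Tᴴ * Uᴴ * T * (Tᴴ * L * T) = Tᴴ * L * T * (Tᴴ * Uᴴ * T)
  calc Tᴴ * Uᴴ * T * (Tᴴ * L * T) = ((Tᴴ * Uᴴ * T) * Tᴴ) * L * T := by
        simp only [Matrix.mul_assoc]
    _ = Tᴴ * (Uᴴ * L) * T := by rw [← h2]; simp only [Matrix.mul_assoc]
    _ = Tᴴ * L * (T * (Tᴴ * Uᴴ * T)) := by rw [h0, ← h1]; simp only [Matrix.mul_assoc]
    _ = _ := by simp only [Matrix.mul_assoc]

end Compression

/-! ### One-dimensional catalysts. -/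

section TrivialCatalysts

theorem apply_eq_trace_of_subsingleton {ι : Type*} [Fintype ι] [Subsingleton ι]
    (X : Matrix ι ι ℂ) (a b : ι) : X a b = X.trace := by
  rw [Matrix.trace, Fintype.sum_subsingleton _ a, diag_apply, Subsingleton.elim b a]

theorem trace_siteMarginal {n : ℕ} {C : Fin n → Type*} [∀ i, Fintype (C i)]
    [∀ i, DecidableEq (C i)] (i : Fin n) (X : Matrix (∀ i, C i) (∀ i, C i) ℂ) :
    (siteMarginal i X).trace = X.trace := by
  have h := trace_mul_atSite i X 1
  rw [atSite_eq_piTensor, Function.update_eq_self, piTensor_one, Matrix.mul_one,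
    Matrix.mul_one] at h
  exact h.symm

theorem atSite_zero {n : ℕ} {C : Fin n → Type*} [∀ i, DecidableEq (C i)] (i : Fin n) :
    atSite i (0 : Matrix (C i) (C i) ℂ) = 0 := by
  ext c c'
  simp [atSite]

end TrivialCatalysts

namespace Dilation

variable {S : Type*} [Fintype S] [DecidableEq S] {β : ℝ} {HS : Matrix S S ℂ} {n : ℕ}

theorem trace_traceFst_sysCatOut (D : Dilation β HS n) {ρ : Matrix S S ℂ} (hρ : IsState ρ) :
    (traceFst (D.sysCatOut ρ)).trace = 1 := by
  rw [traceFst_sysCatOut, trace_traceFst, trace_traceFst, (D.isState_globalOut hρ).2]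

theorem sysCatOut_eq_of_subsingleton (D : Dilation β HS n) [∀ i, Subsingleton (D.C i)]
    {X : Matrix (∀ i, D.C i) (∀ i, D.C i) ℂ} (hX : X.trace = 1) (ρ : Matrix S S ℂ) :
    D.sysCatOut ρ = D.channel ρ ⊗ₖ X := by
  ext ⟨s, c⟩ ⟨s', c'⟩
  rw [kroneckerMap_apply, apply_eq_trace_of_subsingleton X, hX, mul_one,
    Subsingleton.elim c' c]
  change ∑ b, D.globalOut ρ (s, (b, c)) (s', (b, c)) = ∑ e, D.globalOut ρ (s, e) (s', e)
  rw [Fintype.sum_prod_type]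
  exact Finset.sum_congr rfl fun b _ =>
    (Fintype.sum_subsingleton (fun c => D.globalOut ρ (s, (b, c)) (s', (b, c))) c).symm

/-- On one-dimensional catalysts a matrix is determined by its trace, so normalisation alone gives
local return and absence of correlations. -/
theorem isCCTO_of_subsingleton (D : Dilation β HS n) [∀ i, Subsingleton (D.C i)] :
    D.IsCCTO := fun ρ hρ => by
  refine ⟨fun i => ?_, D.sysCatOut_eq_of_subsingleton (D.trace_traceFst_sysCatOut hρ) ρ⟩
  ext a b
  rw [apply_eq_trace_of_subsingleton (siteMarginal i (traceFst (D.sysCatOut ρ))) a b,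
    apply_eq_trace_of_subsingleton (D.η i),
    trace_siteMarginal, D.trace_traceFst_sysCatOut hρ, (D.stateC i).2]

theorem isCTO_of_subsingleton (D : Dilation β HS n) [∀ i, Subsingleton (D.C i)] (hn : n = 1) :
    D.IsCTO :=
  ⟨hn, fun ρ _ => D.sysCatOut_eq_of_subsingleton D.isState_catState.2 ρ⟩

theorem IsCCTO.isNCTO {D : Dilation β HS n} (h : D.IsCCTO) : D.IsNCTO :=
  fun ρ hρ => (h ρ hρ).1

theorem IsCTO.isNCTO {D : Dilation β HS n} (h : D.IsCTO) : D.IsNCTO := fun ρ hρ i => by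
  have hT : (D.channel ρ).trace = 1 := (D.isState_globalOut hρ).traceSnd.2
  rw [h.2 ρ hρ, traceFst_kronecker, hT, one_smul, catState,
    siteMarginal_piTensor i fun i => (D.stateC i).2]

/-- The intertwining relation pulls `1 ⊗ₖ J` outside the evolved state on both sides; cyclicity of
the environment trace then cancels it against its adjoint. -/
theorem channel_eq_recovery_of_isometry {D D' : Dilation β HS n} {J : Matrix D.Env D'.Env ℂ}
    (hJ : Jᴴ * J = 1) (hE : J * D'.envState * Jᴴ = D.envState)
    (hU : D.Uᴴ * ((1 : Matrix S S ℂ) ⊗ₖ J) = ((1 : Matrix S S ℂ) ⊗ₖ J) * D'.U)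
    (X : Matrix S S ℂ) : D'.channel X = D.recovery X := by
  set T := (1 : Matrix S S ℂ) ⊗ₖ J with hT
  have hTT : Tᴴ = (1 : Matrix S S ℂ) ⊗ₖ Jᴴ := by
    rw [hT, conjTranspose_kronecker, conjTranspose_one]
  have hTT1 : Tᴴ * T = 1 := by
    rw [hTT, hT, ← mul_kronecker_mul, hJ, Matrix.one_mul, one_kronecker_one]
  have h1 : X ⊗ₖ D.envState = T * (X ⊗ₖ D'.envState) * Tᴴ := by
    rw [hTT, hT, ← mul_kronecker_mul, ← mul_kronecker_mul, hE, Matrix.one_mul, Matrix.mul_one]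
  have hU' : Tᴴ * D.U = D'.Uᴴ * Tᴴ := by
    have h := congrArg conjTranspose hU
    simpa only [conjTranspose_mul, conjTranspose_conjTranspose] using h
  change traceSnd (D'.U * (X ⊗ₖ D'.envState) * D'.Uᴴ) =
    traceSnd (D.Uᴴ * (X ⊗ₖ D.envState) * D.U)
  have h2 : D.Uᴴ * (X ⊗ₖ D.envState) * D.U =
      T * (D'.U * (X ⊗ₖ D'.envState) * D'.Uᴴ * Tᴴ) := by
    calc D.Uᴴ * (X ⊗ₖ D.envState) * D.U
        = (D.Uᴴ * T) * (X ⊗ₖ D'.envState) * (Tᴴ * D.U) := by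
          rw [h1]; simp only [Matrix.mul_assoc]
      _ = _ := by rw [hU, hU']; simp only [Matrix.mul_assoc]
  rw [h2, hT, traceSnd_one_kronecker_mul_comm, ← hT, Matrix.mul_assoc _ Tᴴ T, hTT1, Matrix.mul_one]

/-- The inverse dynamics of `D` on the support of its environment state `V diag(r) Vᴴ`, which serves
as a bath with Hamiltonian `-β⁻¹ log ρ_E`, accompanied by one-dimensional catalysts. The basis `B'`
of the support is the part of the eigenbasis `V` selected by `f`. -/
theorem exists_runsInverseOf_of_eigenbasis [Nonempty S] (hβ : 0 < β) (hHS : HS.IsHermitian)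
    (D : Dilation β HS n) (hret : D.ReturnsCatalysts (gibbs β HS)) {V : Matrix D.Env D.Env ℂ}
    (hV : V ∈ unitaryGroup D.Env ℂ) {r : D.Env → ℝ} (hVr : D.envState = conjDiag V r)
    {B' : Type} [Fintype B'] [DecidableEq B'] [Nonempty B'] (g : B' → D.Env)
    (hg : Function.Injective g) (hgr : ∀ e, e ∈ Set.range g ↔ r e ≠ 0) :
    ∃ D' : Dilation β HS n, (∀ i, Subsingleton (D'.C i)) ∧ D'.RunsInverseOf D ∧
      ∀ X : Matrix S S ℂ, D'.channel X = D.recovery X := by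
  obtain ⟨W, hW, h, hWh⟩ := exists_conjDiag hHS
  have hr0 : ∀ e, 0 ≤ r e := nonneg_of_posSemidef_conjDiag hV (hVr ▸ D.isState_envState.1)
  have hr1 : ∑ e, r e = 1 := by
    have h1 := D.isState_envState.2
    rw [hVr, trace_conjDiag hV] at h1
    exact_mod_cast h1
  have hz := sum_exp_pos (fun j => -β * h j)
  -- Equality of the eigenvalues of the thermal product state, with the partition function of the
  -- system cancelled.
  have hrel : ∀ j k : S × D.Env, ((W ⊗ₖ V)ᴴ * D.U * (W ⊗ₖ V)) j k ≠ 0 →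
      Real.exp (-β * h j.1) * r j.2 = Real.exp (-β * h k.1) * r k.2 := by
    intro j k hjk
    have h1 := D.eigenvalue_eq_of_returns hHS hret hW
      (by rw [hWh, gibbs_conjDiag hW]) hV hVr j k hjk
    rw [mul_assoc, mul_assoc] at h1
    exact mul_left_cancel₀ (inv_pos.mpr hz).ne' h1
  have hrel0 : ∀ j k : S × D.Env, ((W ⊗ₖ V)ᴴ * D.U * (W ⊗ₖ V)) j k ≠ 0 →
      (r j.2 = 0 ↔ r k.2 = 0) := by
    intro j k hjk
    have h1 := hrel j k hjk
    constructor <;> intro h0 <;> rw [h0, mul_zero] at h1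
    · exact (mul_eq_zero.mp h1.symm).resolve_left (Real.exp_pos _).ne'
    · exact (mul_eq_zero.mp h1).resolve_left (Real.exp_pos _).ne'
  have hgne : ∀ x, r (g x) ≠ 0 := fun x => (hgr _).mp ⟨x, rfl⟩
  let f : B' × (Fin n → Unit) → D.Env := fun x => g x.1
  have hf : Function.Injective f := fun x y hxy => Prod.ext (hg hxy) (Subsingleton.elim _ _)
  have hrange : ∀ e, e ∉ Set.range f → r e = 0 := fun e he => by
    by_contra hne
    obtain ⟨x, hx⟩ := (hgr e).mpr hne
    exact he ⟨(x, fun _ => ()), hx⟩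
  let J : Matrix D.Env (B' × (Fin n → Unit)) ℂ := V.submatrix id f
  -- Indicator of the support of the environment state; `conjDiag V χ` is the support projection.
  let χ : D.Env → ℝ := fun e => if r e = 0 then 0 else 1
  have hχ : ∀ x, χ (f x) = 1 := fun x => if_neg (hgne _)
  have hJJ : Jᴴ * J = 1 := by
    have h1 := conj_submatrix_conjDiag hV hf fun _ => 1
    rw [conjDiag_const hV, Complex.ofReal_one, one_smul, Matrix.mul_one] at h1
    exact h1.trans diagonal_one
  have hJχ : J * Jᴴ = conjDiag V χ := by
    rw [← submatrix_conj_diagonal V hf (g := χ) fun e he => if_pos (hrange e he)]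
    simp only [hχ, Complex.ofReal_one, diagonal_one, Matrix.mul_one, J]
  let T : Matrix (S × D.Env) (S × B' × (Fin n → Unit)) ℂ := (1 : Matrix S S ℂ) ⊗ₖ J
  have hTc : Tᴴ = (1 : Matrix S S ℂ) ⊗ₖ Jᴴ := by
    rw [conjTranspose_kronecker, conjTranspose_one]
  have hTT : Tᴴ * T = 1 := by
    rw [hTc, ← mul_kronecker_mul, hJJ, Matrix.one_mul, one_kronecker_one]
  have hone : (1 : Matrix S S ℂ) = conjDiag W fun _ => 1 := by simp [conjDiag_const hW]
  have hTT' : T * Tᴴ = conjDiag (W ⊗ₖ V) fun x => χ x.2 := by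
    rw [hTc, ← mul_kronecker_mul, hJχ, Matrix.one_mul, hone, kronecker_conjDiag]
    simp only [one_mul]
  have hcommT : Commute D.U (T * Tᴴ) := by
    rw [hTT']
    refine commute_conjDiag (kronecker_mem_unitaryGroup hW hV) fun j k hjk => ?_
    simp only [χ, hrel0 j k hjk]
  -- Energies chosen so that `exp (-β * b e) = r e` on the support; off it `Real.log 0 = 0` makes
  -- `b` vanish.
  let b : D.Env → ℝ := fun e => -β⁻¹ * Real.log (r e)
  let L : Matrix (S × D.Env) (S × D.Env) ℂ :=
    HS ⊗ₖ conjDiag V χ + (1 : Matrix S S ℂ) ⊗ₖ conjDiag V b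
  have hA : HS ⊗ₖ conjDiag V χ = conjDiag (W ⊗ₖ V) fun x => h x.1 * χ x.2 :=
    (congrArg (· ⊗ₖ conjDiag V χ) hWh).trans (kronecker_conjDiag W V h χ)
  have hL : L = conjDiag (W ⊗ₖ V) fun x => h x.1 * χ x.2 + b x.2 := by
    simp only [L]
    rw [hone]
    rw [hA, kronecker_conjDiag, conjDiag_add]
    congr 1
    funext x
    simp
  -- On the support this is the logarithm of `hrel` divided by `-β`; off the support `L` is zero
  -- thanks to the cutoff `χ`.
  have hcommL : Commute D.U L := by
    rw [hL]
    refine commute_conjDiag (kronecker_mem_unitaryGroup hW hV) fun j k hjk => ?_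
    have h0 := hrel0 j k hjk
    by_cases hj : r j.2 = 0
    · simp [χ, b, hj, h0.mp hj]
    · have hk : r k.2 ≠ 0 := fun hk => hj (h0.mpr hk)
      have h1 := congrArg Real.log (hrel j k hjk)
      rw [Real.log_mul (Real.exp_pos _).ne' hj, Real.log_mul (Real.exp_pos _).ne' hk,
        Real.log_exp, Real.log_exp] at h1
      simp only [χ, b, hj, hk, if_false, mul_one]
      field_simp
      linarith
  have hLh : L.IsHermitian := by rw [hL]; exact conjDiag_conjTranspose _ _
  obtain ⟨hU1, hU2, hU3⟩ := compress_unitary D.unitary hTT hcommT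
  have hcomm' := compress_commute hcommL hLh hU1 hU2
  have hb : Jᴴ * conjDiag V b * J =
      (diagonal fun x : B' => (b (g x) : ℂ)) ⊗ₖ (1 : Matrix (Fin n → Unit) (Fin n → Unit) ℂ) := by
    rw [conj_submatrix_conjDiag hV hf, ← diagonal_one, diagonal_kronecker_diagonal]
    simp only [mul_one]
    rfl
  have hTL : Tᴴ * L * T = HS ⊗ₖ (1 : Matrix (B' × (Fin n → Unit)) (B' × (Fin n → Unit)) ℂ) + (1 : Matrix S S ℂ) ⊗ₖ
      ((diagonal fun x : B' => (b (g x) : ℂ)) ⊗ₖ (1 : Matrix (Fin n → Unit) (Fin n → Unit) ℂ)) := by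
    have hχ1 : Jᴴ * conjDiag V χ * J = 1 := by
      rw [← hJχ, ← Matrix.mul_assoc, hJJ, Matrix.one_mul, hJJ]
    rw [← hb, ← hχ1, hTc, Matrix.mul_add, Matrix.add_mul]
    simp only [← mul_kronecker_mul, Matrix.one_mul, Matrix.mul_one, T]
  let D' : Dilation β HS n :=
    { B := B'
      C := fun _ => Unit
      HB := diagonal fun x : B' => (b (g x) : ℂ)
      hermB := by
        rw [IsHermitian, diagonal_conjTranspose]
        congr 1
        funext x
        simp
      HC := fun _ => 0
      hermC := fun _ => isHermitian_zero
      η := fun _ => (1 : Matrix Unit Unit ℂ)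
      stateC := fun _ => ⟨PosSemidef.one, by simp⟩
      U := Tᴴ * D.Uᴴ * T
      unitary := hU3
      energy := by
        have h1 := hcomm'
        rw [hTL] at h1
        rw [Finset.sum_eq_zero fun i _ => atSite_zero i, kronecker_zero, add_zero]
        exact h1 }
  have hgibbs : gibbs β D'.HB = diagonal fun x : B' => (r (g x) : ℂ) := by
    have h1 : ∀ g : B' → ℝ, (diagonal fun x => (g x : ℂ)) = conjDiag 1 g := fun g => by
      rw [conjDiag, conjTranspose_one, Matrix.one_mul, Matrix.mul_one]
    have hexp : ∀ x : B', Real.exp (-β * b (g x)) = r (g x) := fun x => by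
      have hx : 0 < r (g x) := lt_of_le_of_ne (hr0 _) (hgne x).symm
      have h2 : -β * b (g x) = Real.log (r (g x)) := by
        simp only [b]; field_simp
      rw [h2, Real.exp_log hx]
    -- The partition function of the new bath is the trace of the environment state, so no
    -- normalisation is needed.
    have hsum : ∑ x : B', r (g x) = 1 := by
      rw [← hr1]
      refine Fintype.sum_of_injective g hg _ _ (fun e he => ?_) fun x => rfl
      by_contra h0
      exact he ((hgr e).mpr h0)
    change gibbs β (diagonal fun x : B' => (b (g x) : ℂ)) = _
    rw [h1 fun x => b (g x), gibbs_conjDiag (one_mem _), h1 fun x => r (g x)]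
    simp only [hexp, hsum, inv_one, one_mul]
  have hEnv : D'.envState = diagonal fun x : B' × (Fin n → Unit) => (r (f x) : ℂ) := by
    have h1 : D'.catState = (1 : Matrix (Fin n → Unit) (Fin n → Unit) ℂ) := piTensor_one
    rw [envState, hgibbs, h1, ← diagonal_one, diagonal_kronecker_diagonal]
    simp only [mul_one]
    rfl
  have hEJ : J * D'.envState * Jᴴ = D.envState := by
    rw [hEnv, hVr]
    exact submatrix_conj_diagonal V hf hrange
  exact ⟨D', fun _ => inferInstanceAs (Subsingleton Unit), ⟨J, hJJ, hEJ, hU1⟩,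
    channel_eq_recovery_of_isometry (D' := D') hJJ hEJ hU1⟩

theorem exists_runsInverseOf [Nonempty S] (hβ : 0 < β) (hHS : HS.IsHermitian)
    (D : Dilation β HS n) (hret : D.ReturnsCatalysts (gibbs β HS)) :
    ∃ D' : Dilation β HS n, (∀ i, Subsingleton (D'.C i)) ∧ D'.RunsInverseOf D ∧
      ∀ X : Matrix S S ℂ, D'.channel X = D.recovery X := by
  obtain ⟨V, hV, r, hVr⟩ := exists_conjDiag D.isState_envState.1.1
  have hne : Nonempty {e : D.Env // r e ≠ 0} := by
    by_contra hne
    have h1 := D.isState_envState.2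
    rw [hVr, trace_conjDiag hV, Finset.sum_eq_zero fun e _ => ?_, Complex.ofReal_zero] at h1
    · exact zero_ne_one h1
    · by_contra h0
      exact hne ⟨⟨e, h0⟩⟩
  exact D.exists_runsInverseOf_of_eigenbasis hβ hHS hret hV hVr
    (Subtype.val : {e : D.Env // r e ≠ 0} → D.Env) Subtype.val_injective fun e => by simp

end Dilation

end QThermo

end

theorem theorem2 {S : Type*} [Fintype S] [DecidableEq S] [Nonempty S]
    (β : ℝ) (hβ : 0 < β) (HS : Matrix S S ℂ) (hHS : HS.IsHermitian) (n : ℕ)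
    (D : QThermo.Dilation β HS n) :
    -- the inequality, when the catalysts are returned on the given input or on the thermal input
    (∀ ρ : Matrix S S ℂ, QThermo.IsState ρ →
      D.ReturnsCatalysts ρ ∨ D.ReturnsCatalysts (QThermo.gibbs β HS) →
      QThermo.relEntropy ρ (D.recovery (D.channel ρ)) ≤
        QThermo.relEntropy ρ (QThermo.gibbs β HS)
          - QThermo.relEntropy (D.channel ρ) (QThermo.gibbs β HS)) ∧
    -- `R` is the Petz recovery map, and the inverse unitary gives an operation of the same kind
    (D.ReturnsCatalysts (QThermo.gibbs β HS) →
      D.channel (QThermo.gibbs β HS) = QThermo.gibbs β HS ∧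
      (∀ X : Matrix S S ℂ, D.recovery X = QThermo.petz D.channel (QThermo.gibbs β HS) X) ∧
      (∀ X : Matrix S S ℂ, D.reverse.channel X = D.recovery X) ∧
      D.reverse.globalOut (QThermo.gibbs β HS) = QThermo.gibbs β HS ⊗ₖ D.envState ∧
      D.reverse.ReturnsCatalysts (QThermo.gibbs β HS)) ∧
    -- `R` belongs to the class of `n`-catalytic thermal operations
    (D.IsNCTO → ∃ D' : QThermo.Dilation β HS n, D'.IsNCTO ∧ D'.RunsInverseOf D ∧
      ∀ X : Matrix S S ℂ, D'.channel X = D.recovery X) ∧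
    -- correlating-catalytic and catalytic thermal operations are special cases, with `R` in the
    -- same class
    (D.IsCCTO → D.IsNCTO ∧ ∃ D' : QThermo.Dilation β HS n, D'.IsCCTO ∧ D'.RunsInverseOf D ∧
      ∀ X : Matrix S S ℂ, D'.channel X = D.recovery X) ∧
    (D.IsCTO → D.IsNCTO ∧ ∃ D' : QThermo.Dilation β HS n, D'.IsCTO ∧ D'.RunsInverseOf D ∧
      ∀ X : Matrix S S ℂ, D'.channel X = D.recovery X) := by
  have hτ := QThermo.isState_gibbs β hHS
  refine ⟨fun ρ hρ hret => ?_, fun hret => ?_, fun h => ?_, fun h => ⟨h.isNCTO, ?_⟩,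
    fun h => ⟨h.isNCTO, ?_⟩⟩
  · rcases hret with hret | hret
    · exact D.relEntropy_recovery_le hHS hρ
        (D.ker_envState_le (D.isState_globalOut hρ).1 ((D.returnsCatalysts_iff ρ).mp hret))
        (D.balance_of_returns hHS hρ hret)
    · obtain ⟨hker, hbal⟩ := D.balance_of_returns_gibbs hHS hret hρ
      exact D.relEntropy_recovery_le hHS hρ hker hbal
  · exact ⟨D.channel_gibbs hHS hret, D.recovery_eq_petz hHS hret, D.reverse_channel,
      D.reverse_globalOut_gibbs hHS hret, D.reverse_returnsCatalysts_gibbs hHS hret⟩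
  -- Only the return of the catalysts on the thermal input is used here; the class of `D'` comes
  -- from its catalysts being one-dimensional.
  · obtain ⟨D', hsub, hrun, hch⟩ := D.exists_runsInverseOf hβ hHS (h _ hτ)
    exact ⟨D', D'.isCCTO_of_subsingleton.isNCTO, hrun, hch⟩
  · obtain ⟨D', hsub, hrun, hch⟩ := D.exists_runsInverseOf hβ hHS (h.isNCTO _ hτ)
    exact ⟨D', D'.isCCTO_of_subsingleton, hrun, hch⟩
  · obtain ⟨D', hsub, hrun, hch⟩ := D.exists_runsInverseOf hβ hHS (h.isNCTO _ hτ)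
    exact ⟨D', D'.isCTO_of_subsingleton h.1, hrun, hch⟩
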